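/- Let $H=L^2(\mathbb R)$ be the Hilbert space of a single bosonic mode, with annihilation operator $a=(\hat x+i\hat p)/\sqrt2$ ($\hbar=1$) and displacement operators $D(\xi)=\exp(\xi a^\dagger-\xi^*a)$, $\xi\in\mathbb C$. The characteristic function of a trace-class operator $\rho$ on $H$ is $\Phi_\rho(\xi)=\operatorname{Tr}[\rho D(\xi)]$. For a function $f:\mathbb C\to\mathbb C$, its Narcowich–Wigner spectrum $\mathcal W\{f\}$ is the set of all real $\eta$ such that, for every finite family $\xi_1,\dots,\xi_n\in\mathbb C$, the matrix with entries $$F_{jk}=f(\xi_j-\xi_k)\exp\!\Big(\tfrac{\eta}{4}(\xi_j\xi_k^*-\xi_j^*\xi_k)\Big)$$ is positive semidefinite. A filter function is a continuous $\Omega:\mathbb C\to\mathbb C$ with $\Omega(0)=1$; a filtering map of $\Omega$ is a linear map $\mathcal E_\Omega$ of the trace-class operators on $H$ to themselves with $\Phi_{\mathcal E_\Omega(\rho)}(\xi)=\Phi_\rho(\xi)\,\Omega(\xi)$ for all trace-class $\rho$ and all $\xi\in\mathbb C$. (1) Let $\Omega$ be a filter function with $4\in\mathcal W\{\Omega\}$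 and $0\notin\mathcal W\{\Omega\}$. Then there is exactly one filtering map $\mathcal E_\Omega$; it maps every density operator on $H$ (positive trace-class operator of trace one) to a density operator, but it is not completely positive, i.e. for some $n$ the map $\mathcal E_\Omega\otimes\mathrm{id}$ on the trace-class operators on $H\otimes\mathbb C^n$ sends some positive operator to a non-positive one. (2) The function $\Phi_{\rm ker}(\xi)=\big(1-\tfrac32|\xi|^2\big)e^{-|\xi|^2}$ is such a filter function: it is continuous, $\Phi_{\rm ker}(0)=1$, $4\in\mathcal W\{\Phi_{\rm ker}\}$ and $0\notin\mathcal W\{\Phi_{\rm ker}\}$. It is integrable, and its Fourier transform $$\tilde\Phi_{\rm ker}(\alpha)=\frac1{\pi^2}\int_{\mathbb C}d^2\xi\;\Phi_{\rm ker}(\xi)\,e^{\alpha\xi^*-\xi\alpha^*}$$ is real-valued and takes negative values. -/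

import Mathlib

open scoped ComplexOrder

noncomputable section

namespace PhaseSpace

section TraceClass

variable {H : Type} [NormedAddCommGroup H] [InnerProductSpace ℂ H] [CompleteSpace H]

/-- A fixed orthonormal (Hilbert) basis of `H`, used only to write down traces. -/
def stdBasis (H : Type) [NormedAddCommGroup H] [InnerProductSpace ℂ H] [CompleteSpace H] :
    HilbertBasis (exists_hilbertBasis ℂ H).choose ℂ H :=
  (exists_hilbertBasis ℂ H).choose_spec.choose

/-- The trace `Tr T = ∑ᵢ ⟨eᵢ, T eᵢ⟩`. On trace-class operators the series converges and the value
does not depend on the orthonormal basis, see `hasSum_trace`. -/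
def trace (T : H →L[ℂ] H) : ℂ := ∑' i, inner ℂ (stdBasis H i) (T (stdBasis H i))

/-- Positive operators with finite trace. -/
def IsPosTraceClass (T : H →L[ℂ] H) : Prop :=
  T.IsPositive ∧ Summable fun i => inner ℂ (stdBasis H i) (T (stdBasis H i))

/-- The trace-class operators: the complex linear span of the positive operators of
finite trace. -/
def traceClass (H : Type) [NormedAddCommGroup H] [InnerProductSpace ℂ H] [CompleteSpace H] :
    Submodule ℂ (H →L[ℂ] H) :=
  Submodule.span ℂ {T | IsPosTraceClass T}

/-- Density operators: positive trace-class operators with trace one. -/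
def IsDensityOperator (ρ : H →L[ℂ] H) : Prop :=
  ρ.IsPositive ∧ ρ ∈ traceClass H ∧ trace ρ = 1

theorem ennreal_sum_basis_indep {ι κ : Type} (b : HilbertBasis ι ℂ H) (c : HilbertBasis κ ℂ H)
    (S : H →L[ℂ] H) (hS : IsSelfAdjoint S) :
    ∑' i, ENNReal.ofReal (‖S (b i)‖ ^ 2) = ∑' j, ENNReal.ofReal (‖S (c j)‖ ^ 2) := by
  have key : ∀ {α : Type} (d : HilbertBasis α ℂ H) (x : H),
      ENNReal.ofReal (‖x‖ ^ 2) = ∑' j, ENNReal.ofReal (‖inner ℂ (d j) x‖ ^ 2) := by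
    intro α d x
    have h := d.hasSum_inner_mul_inner x x
    have h2 : HasSum (fun j => ‖inner ℂ (d j) x‖ ^ 2) (‖x‖ ^ 2) := by
      have h3 := Complex.hasSum_re h
      convert h3 using 1
      · funext j
        rw [← inner_conj_symm x (d j), ← Complex.normSq_eq_conj_mul_self, Complex.ofReal_re,
          Complex.normSq_eq_norm_sq]
      · rw [inner_self_eq_norm_sq_to_K]
        norm_cast
    rw [← h2.tsum_eq, ENNReal.ofReal_tsum_of_nonneg (fun _ => by positivity) h2.summable]
  have h1 : ∀ i, ENNReal.ofReal (‖S (b i)‖ ^ 2)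
      = ∑' j, ENNReal.ofReal (‖inner ℂ (c j) (S (b i))‖ ^ 2) := fun i => key c _
  have h2 : ∀ j, ENNReal.ofReal (‖S (c j)‖ ^ 2)
      = ∑' i, ENNReal.ofReal (‖inner ℂ (b i) (S (c j))‖ ^ 2) := fun j => key b _
  simp_rw [h1, h2]
  rw [ENNReal.tsum_comm]
  refine tsum_congr fun j => tsum_congr fun i => ?_
  have : inner ℂ (b i) (S (c j)) = (starRingEnd ℂ) (inner ℂ (c j) (S (b i))) := by
    rw [inner_conj_symm, ← ContinuousLinearMap.adjoint_inner_left, hS.adjoint_eq]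
  rw [this, RCLike.norm_conj]

theorem IsPosTraceClass.hasSum {T : H →L[ℂ] H} (hT : IsPosTraceClass T) {ι : Type}
    (b : HilbertBasis ι ℂ H) : HasSum (fun i => inner ℂ (b i) (T (b i))) (trace T) := by
  have hT0 : (0 : H →L[ℂ] H) ≤ T := (ContinuousLinearMap.nonneg_iff_isPositive T).2 hT.1
  set S : H →L[ℂ] H := CFC.sqrt T with hSdef
  have hS : IsSelfAdjoint S := (CFC.sqrt_nonneg T).isSelfAdjoint
  have hSS : S * S = T := CFC.sqrt_mul_sqrt_self T hT0
  have hin : ∀ x, inner ℂ x (T x) = ((‖S x‖ ^ 2 : ℝ) : ℂ) := by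
    intro x
    rw [← hSS, mul_apply_eq_comp, ← ContinuousLinearMap.adjoint_inner_left,
      hS.adjoint_eq, inner_self_eq_norm_sq_to_K]
    norm_cast
  have hs0 : Summable fun i => ‖S (stdBasis H i)‖ ^ 2 := by
    have := hT.2
    simp_rw [hin] at this
    exact Complex.summable_ofReal.1 this
  have hind := ennreal_sum_basis_indep b (stdBasis H) S hS
  rw [← ENNReal.ofReal_tsum_of_nonneg (fun _ => by positivity) hs0] at hind
  have hsb : Summable fun i => ‖S (b i)‖ ^ 2 := by
    have hne : ∑' i, ENNReal.ofReal (‖S (b i)‖ ^ 2) ≠ ⊤ := by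
      rw [hind]; exact ENNReal.ofReal_ne_top
    have := ENNReal.summable_toReal hne
    simpa [ENNReal.toReal_ofReal (sq_nonneg _)] using this
  rw [← ENNReal.ofReal_tsum_of_nonneg (fun _ => by positivity) hsb,
    ENNReal.ofReal_eq_ofReal_iff (tsum_nonneg fun _ => by positivity)
      (tsum_nonneg fun _ => by positivity)] at hind
  have htr : trace T = ((∑' i, ‖S (b i)‖ ^ 2 : ℝ) : ℂ) := by
    unfold trace
    simp_rw [hin]
    rw [hind, Complex.ofReal_tsum]
  simp_rw [hin]
  rw [htr]
  exact Complex.hasSum_ofReal.2 hsb.hasSum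

/-- The trace of a trace-class operator may be computed in any orthonormal basis. -/
theorem hasSum_trace {T : H →L[ℂ] H} (hT : T ∈ traceClass H) {ι : Type}
    (b : HilbertBasis ι ℂ H) : HasSum (fun i => inner ℂ (b i) (T (b i))) (trace T) := by
  suffices h : ∃ t : ℂ, ∀ (κ : Type) (c : HilbertBasis κ ℂ H),
      HasSum (fun i => inner ℂ (c i) (T (c i))) t by
    obtain ⟨t, ht⟩ := h
    have : trace T = t := (ht _ (stdBasis H)).tsum_eq
    rw [this]
    exact ht _ b
  induction hT using Submodule.span_induction with
  | mem T hT => exact ⟨trace T, fun κ c => IsPosTraceClass.hasSum hT c⟩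
  | zero => exact ⟨0, fun κ c => by simp⟩
  | add S T _ _ hS hT =>
    obtain ⟨s, hs⟩ := hS
    obtain ⟨t, ht⟩ := hT
    exact ⟨s + t, fun κ c => by simpa [inner_add_right] using (hs κ c).add (ht κ c)⟩
  | smul a T _ hT =>
    obtain ⟨t, ht⟩ := hT
    exact ⟨a * t, fun κ c => by simpa [inner_smul_right] using (ht κ c).mul_left a⟩

/-- An `n × n` array `(T j k)` of operators is positive when, as an operator on
`H ⊗ ℂⁿ = H ⊕ ⋯ ⊕ H`, it has nonnegative quadratic form. -/
def BlockPositive {n : ℕ} (T : Fin n → Fin n → H →L[ℂ] H) : Prop :=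
  ∀ v : Fin n → H, 0 ≤ ∑ j, ∑ k, inner ℂ (v j) (T j k (v k))

/-- Complete positivity of a linear map `E` of trace-class operators: for every `n`, the map
`E ⊗ id` on trace-class operators on `H ⊗ ℂⁿ` (that is, on `n × n` arrays of trace-class operators
on `H`) sends positive operators to positive operators. -/
def IsCompletelyPositive (E : traceClass H →ₗ[ℂ] traceClass H) : Prop :=
  ∀ (n : ℕ) (T : Fin n → Fin n → traceClass H),
    BlockPositive (fun j k => (T j k : H →L[ℂ] H)) →
      BlockPositive (fun j k => (E (T j k) : H →L[ℂ] H))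

/-- `E` sends density operators to density operators. -/
def PreservesDensityOperators (E : traceClass H →ₗ[ℂ] traceClass H) : Prop :=
  ∀ ρ : traceClass H, IsDensityOperator (ρ : H →L[ℂ] H) → IsDensityOperator (E ρ : H →L[ℂ] H)

end TraceClass

section Displacement

/-- The Hilbert space `L²(ℝ)` of a single bosonic mode, in the position representation. -/
abbrev Mode : Type := MeasureTheory.Lp ℂ 2 (MeasureTheory.volume : MeasureTheory.Measure ℝ)

/-- The action of `D(ξ) = exp(ξ a† - ξ* a)` on wave functions. Since `a = (x + i p) / √2`,
`p = -i d/dx`, one has `ξ a† - ξ* a = i √2 (Im ξ · x - Re ξ · p)`. -/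
def displacementFun (ξ : ℂ) (ψ : ℝ → ℂ) (x : ℝ) : ℂ :=
  Complex.exp (Complex.I * ((√2 * ξ.im * x - ξ.re * ξ.im : ℝ) : ℂ)) * ψ (x - √2 * ξ.re)

/-- Annihilation operator `a = (x + d/dx) / √2` on differentiable wave functions. -/
def annihilationFun (ψ : ℝ → ℂ) (x : ℝ) : ℂ := (x * ψ x + deriv ψ x) / √2

/-- Creation operator `a† = (x - d/dx) / √2` on differentiable wave functions. -/
def creationFun (ψ : ℝ → ℂ) (x : ℝ) : ℂ := (x * ψ x - deriv ψ x) / √2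

theorem displacementFun_zero (ψ : ℝ → ℂ) : displacementFun 0 ψ = ψ := by
  funext x; simp [displacementFun]

/-- `t ↦ D(t ξ) ψ` solves the evolution equation with generator `ξ a† - ξ* a`. -/
theorem hasDerivAt_displacementFun (ξ : ℂ) (ψ : ℝ → ℂ) (hψ : Differentiable ℝ ψ) (x t : ℝ) :
    HasDerivAt (fun s : ℝ => displacementFun (s * ξ) ψ x)
      (ξ * creationFun (displacementFun (t * ξ) ψ) x
        - (starRingEnd ℂ) ξ * annihilationFun (displacementFun (t * ξ) ψ) x) t := by
  have h2 : ((√2 : ℝ) : ℂ) ^ 2 = 2 := by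
    rw [← Complex.ofReal_pow, Real.sq_sqrt (by norm_num)]; norm_num
  have h2' : ((√2 : ℝ) : ℂ) ≠ 0 := by
    simp
  have hph : ∀ s y : ℝ, displacementFun (s * ξ) ψ y =
      Complex.exp (Complex.I * ((√2 * (s * ξ.im) * y - (s * ξ.re) * (s * ξ.im) : ℝ) : ℂ))
        * ψ (y - √2 * (s * ξ.re)) := by
    intro s y; simp [displacementFun]
  have hx : HasDerivAt (displacementFun (t * ξ) ψ)
      (Complex.exp (Complex.I * ((√2 * (t * ξ.im) * x - (t * ξ.re) * (t * ξ.im) : ℝ) : ℂ))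
        * (Complex.I * ((√2 * (t * ξ.im) : ℝ) : ℂ)) * ψ (x - √2 * (t * ξ.re))
        + Complex.exp (Complex.I * ((√2 * (t * ξ.im) * x - (t * ξ.re) * (t * ξ.im) : ℝ) : ℂ))
        * deriv ψ (x - √2 * (t * ξ.re))) x := by
    have e1 : HasDerivAt (fun y : ℝ => √2 * (t * ξ.im) * y - (t * ξ.re) * (t * ξ.im))
        (√2 * (t * ξ.im)) x := by
      simpa using ((hasDerivAt_id x).const_mul (√2 * (t * ξ.im))).sub_const ((t * ξ.re) * (t * ξ.im))
    have e2 : HasDerivAt (fun y : ℝ => y - √2 * (t * ξ.re)) 1 x := (hasDerivAt_id x).sub_const (√2 * (t * ξ.re))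
    have e3 := ((e1.ofReal_comp.const_mul Complex.I).cexp).mul
      ((hψ (x - √2 * (t * ξ.re))).hasDerivAt.scomp x e2)
    refine (e3.congr_deriv ?_).congr_of_eventuallyEq (Filter.Eventually.of_forall (hph t))
    simp
  have e1 : HasDerivAt (fun s : ℝ => √2 * (s * ξ.im) * x - (s * ξ.re) * (s * ξ.im))
      (√2 * ξ.im * x - 2 * t * ξ.re * ξ.im) t := by
    have := (((hasDerivAt_id t).mul_const (√2 * ξ.im * x))).sub
      (((hasDerivAt_id t).pow 2).mul_const (ξ.re * ξ.im))
    refine (this.congr_deriv ?_).congr_of_eventuallyEq (Filter.Eventually.of_forall fun s => ?_)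
    · simp; ring
    · simp; ring
  have e2 : HasDerivAt (fun s : ℝ => x - √2 * (s * ξ.re)) (-(√2 * ξ.re)) t := by
    have := ((hasDerivAt_id t).mul_const (√2 * ξ.re)).const_sub x
    refine (this.congr_deriv ?_).congr_of_eventuallyEq (Filter.Eventually.of_forall fun s => ?_)
    · simp
    · simp; ring
  have e3 := ((e1.ofReal_comp.const_mul Complex.I).cexp).mul
      ((hψ (x - √2 * (t * ξ.re))).hasDerivAt.scomp t e2)
  refine (e3.congr_deriv ?_).congr_of_eventuallyEq (Filter.Eventually.of_forall fun s => hph s x)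
  unfold creationFun annihilationFun
  rw [hx.deriv, hph t x]
  have hc : (starRingEnd ℂ) ξ = ξ.re - ξ.im * Complex.I := by
    apply Complex.ext <;> simp
  have hx1 : ∀ A B : ℂ, ξ * A - (starRingEnd ℂ) ξ * B =
      (ξ.re + ξ.im * Complex.I) * A - (ξ.re - ξ.im * Complex.I) * B := by
    intro A B; rw [hc, Complex.re_add_im]
  rw [hx1]
  simp only [Function.comp_apply, Complex.real_smul]
  generalize Complex.exp _ = P
  generalize ψ _ = p
  generalize deriv ψ _ = q
  push_cast
  field_simp
  ring_nf
  simp only [h2]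
  ring

theorem displacementFun_memLp (ξ : ℂ) (ψ : Mode) :
    MeasureTheory.MemLp (displacementFun ξ ψ) 2 MeasureTheory.volume := by
  have h1 : MeasureTheory.MemLp (fun x : ℝ => ψ (x - √2 * ξ.re)) 2 MeasureTheory.volume :=
    (MeasureTheory.Lp.memLp ψ).comp_measurePreserving
      (MeasureTheory.measurePreserving_sub_right MeasureTheory.volume (√2 * ξ.re))
  have hc : Continuous fun x : ℝ =>
      Complex.exp (Complex.I * ((√2 * ξ.im * x - ξ.re * ξ.im : ℝ) : ℂ)) := by fun_prop
  refine h1.of_le (hc.aestronglyMeasurable.mul h1.1) (Filter.Eventually.of_forall fun x => ?_)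
  rw [displacementFun, norm_mul, mul_comm Complex.I, Complex.norm_exp_ofReal_mul_I, one_mul]

/-- The displacement operator `D(ξ) = exp(ξ a† - ξ* a)` on `L²(ℝ)`. -/
def displacement (ξ : ℂ) : Mode →L[ℂ] Mode :=
  LinearMap.mkContinuous
    { toFun := fun ψ => (displacementFun_memLp ξ ψ).toLp _
      map_add' := fun ψ φ => by
        rw [← MeasureTheory.MemLp.toLp_add]
        apply MeasureTheory.MemLp.toLp_congr
        have h := (MeasureTheory.measurePreserving_sub_right MeasureTheory.volume
          (√2 * ξ.re)).quasiMeasurePreserving.ae_eq_comp (MeasureTheory.Lp.coeFn_add ψ φ)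
        filter_upwards [h] with x hx
        simp only [Function.comp_apply, Pi.add_apply] at hx
        simp only [displacementFun, Pi.add_apply, hx]
        ring
      map_smul' := fun c ψ => by
        rw [RingHom.id_apply, ← MeasureTheory.MemLp.toLp_const_smul]
        apply MeasureTheory.MemLp.toLp_congr
        have h := (MeasureTheory.measurePreserving_sub_right MeasureTheory.volume
          (√2 * ξ.re)).quasiMeasurePreserving.ae_eq_comp (MeasureTheory.Lp.coeFn_smul c ψ)
        filter_upwards [h] with x hx
        simp only [Function.comp_apply, Pi.smul_apply, smul_eq_mul] at hx
        simp only [displacementFun, Pi.smul_apply, smul_eq_mul, hx]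
        ring }
    1 (fun ψ => by
      have hm := MeasureTheory.measurePreserving_sub_right
        (MeasureTheory.volume : MeasureTheory.Measure ℝ) (√2 * ξ.re)
      rw [one_mul, LinearMap.coe_mk, AddHom.coe_mk,
        ← MeasureTheory.Lp.norm_compMeasurePreserving ψ hm]
      apply MeasureTheory.Lp.norm_le_norm_of_ae_le
      filter_upwards [(displacementFun_memLp ξ ψ).coeFn_toLp,
        MeasureTheory.Lp.coeFn_compMeasurePreserving ψ hm] with x h1 h2
      rw [h1, h2, displacementFun, norm_mul, mul_comm Complex.I, Complex.norm_exp_ofReal_mul_I,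
        one_mul, Function.comp_apply])

theorem coeFn_displacement (ξ : ℂ) (ψ : Mode) :
    displacement ξ ψ =ᵐ[MeasureTheory.volume] displacementFun ξ ψ :=
  (displacementFun_memLp ξ ψ).coeFn_toLp

end Displacement

/-- The characteristic function `Φ(ξ) = Tr[ρ D(ξ)]`. -/
def charFun (ρ : Mode →L[ℂ] Mode) (ξ : ℂ) : ℂ := trace (ρ ∘L displacement ξ)

/-- `E` is the filtering map of the filter function `Ω`: a linear map of the trace-class operators
that multiplies characteristic functions by `Ω`. -/
def IsFilteringMap (Ω : ℂ → ℂ) (E : traceClass Mode →ₗ[ℂ] traceClass Mode) : Prop :=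
  ∀ (ρ : traceClass Mode) (ξ : ℂ), charFun (E ρ) ξ = charFun ρ ξ * Ω ξ

/-- The Narcowich-Wigner spectrum of `f`. -/
def narcowichWignerSpectrum (f : ℂ → ℂ) : Set ℝ :=
  {η | ∀ (n : ℕ) (ξ : Fin n → ℂ),
    (Matrix.of fun j k : Fin n => f (ξ j - ξ k) *
      Complex.exp ((η : ℂ) / 4 * (ξ j * (starRingEnd ℂ) (ξ k)
        - (starRingEnd ℂ) (ξ j) * ξ k))).PosSemidef}

/-- The phase-space Fourier transform
`Ω̃(α) = π⁻² ∫ d²ξ Ω(ξ) exp(α ξ* - ξ α*)`. -/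
def phaseSpaceFourier (Ω : ℂ → ℂ) (α : ℂ) : ℂ :=
  1 / (Real.pi : ℂ) ^ 2 * ∫ ξ : ℂ, Ω ξ *
    Complex.exp (α * (starRingEnd ℂ) ξ - ξ * (starRingEnd ℂ) α)

/-- The filter function `(1 - (3/2) |ξ|²) exp(-|ξ|²)`. -/
def exampleKernel (ξ : ℂ) : ℂ := (((1 - 3 / 2 * ‖ξ‖ ^ 2) * Real.exp (-‖ξ‖ ^ 2) : ℝ) : ℂ)

end PhaseSpace

end

namespace PhaseSpace

open MeasureTheory Complex ComplexConjugate

/-! Write p(ξ, ζ) = ξζ* − ξ*ζ. Everything rests on the Weyl relations for D(ξ) and the orthogonality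
relation `lintegral_enorm_inner_displacement`: the coefficients ξ ↦ ⟨D(ξ)φ, ψ⟩ are square-integrable
with norm √π ‖φ‖ ‖ψ‖. Polarized and summed over T = ∑ |uᵢ⟩⟨uᵢ|, it gives Weyl inversion ⟨φ, Tψ⟩ =
π⁻¹ ∫ Φ_T(ξ) ⟨D(ξ)φ, ψ⟩ d²ξ, so characteristic functions determine trace-class operators. This makes
filtering maps unique, and linear once they exist pointwise.

Existence and positivity (`exists_filtered`): let R be the Weyl transform of F = Φ_T Ω with T ≥ 0.
It is bounded because |Ω| ≤ 1. Then π⟨ψ, Rψ⟩ is the integral of Φ_T Ω ⟨D(·)ψ, ψ⟩. At ξⱼ − ξₖ the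
first and third factors are (sums of) Gram kernels times exp(p(ξⱼ, ξₖ)/2) each; together these
phases form exp(p), exactly the twist that η = 4 allows Ω. By Schur's product theorem the integrand
is positive definite in the ordinary sense, and a continuous integrable function of this kind has
nonnegative integral (`integral_nonneg_of_positiveDefinite`). Finiteness of the trace comes from
integrating coherent-state expectations of R, which is controlled by sup |F|.

Failure of complete positivity (`IsFilteringMap.zero_mem_of_isCompletelyPositive`): apply a
completely positive filtering map to the array |D(−ξⱼ)φ⟩⟨D(−ξₖ)φ| and test on cⱼ D(−ξⱼ)χ. All phases
cancel, leaving the quadratic form of Ω averaged against conj⟨D(ζ)φ, φ⟩ ⟨D(ζ)χ, χ⟩. For Gaussians φ,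
χ squeezed by s and 1/s this weight is an isotropic Gaussian that concentrates at 0 as s → ∞, so Ω
itself is positive definite, that is, 0 lies in its spectrum.

For the example, Φ_ker(ξ) is ¼ of the vacuum plus ¾ of the one-photon characteristic function,
evaluated at √2 ξ. The rescaling doubles the phase of the Gram kernels, which yields η = 4. The
integral of Φ_ker is −π/2, which excludes η = 0 and makes the Fourier transform negative at the
origin. -/

/-! ### Weyl relations and weak continuity of displacement operators -/

theorem norm_displacement_apply_le (ξ : ℂ) (ψ : Mode) : ‖displacement ξ ψ‖ ≤ ‖ψ‖ := by
  have h : ‖displacement ξ‖ ≤ 1 := LinearMap.mkContinuous_norm_le _ zero_le_one _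
  simpa using (displacement ξ).le_of_opNorm_le h ψ

@[simp] theorem displacement_zero : displacement 0 = ContinuousLinearMap.id ℂ Mode := by
  ext1 ψ
  apply Lp.ext
  filter_upwards [coeFn_displacement 0 ψ] with x hx
  rw [hx, displacementFun_zero]
  rfl

theorem displacementFun_displacementFun (ξ ζ : ℂ) (ψ : ℝ → ℂ) (x : ℝ) :
    displacementFun ξ (displacementFun ζ ψ) x =
      exp ((ξ * conj ζ - conj ξ * ζ) / 2) * displacementFun (ξ + ζ) ψ x := by
  have hs : ((√2 : ℝ) : ℂ) ^ 2 = 2 := by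
    rw [← ofReal_pow, Real.sq_sqrt (by norm_num)]; norm_num
  have hphase : ξ * conj ζ - conj ξ * ζ = 2 * I * (ξ.im * ζ.re - ξ.re * ζ.im) := by
    apply Complex.ext <;> (simp; try ring)
  unfold displacementFun
  rw [hphase, ← mul_assoc, ← mul_assoc, ← Complex.exp_add, ← Complex.exp_add]
  congr 1
  · congr 1
    push_cast
    simp only [add_re, add_im, ofReal_add]
    linear_combination (-I * ζ.im * ξ.re) * hs
  · congr 1
    simp only [add_re]
    ring

theorem displacement_displacement (ξ ζ : ℂ) (ψ : Mode) :
    displacement ξ (displacement ζ ψ) =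
      exp ((ξ * conj ζ - conj ξ * ζ) / 2) • displacement (ξ + ζ) ψ := by
  apply Lp.ext
  have h := (measurePreserving_sub_right volume
    (√2 * ξ.re)).quasiMeasurePreserving.ae_eq_comp (coeFn_displacement ζ ψ)
  filter_upwards [coeFn_displacement ξ (displacement ζ ψ), h,
    Lp.coeFn_smul (exp ((ξ * conj ζ - conj ξ * ζ) / 2)) (displacement (ξ + ζ) ψ),
    coeFn_displacement (ξ + ζ) ψ] with x h1 h2 h3 h4
  rw [h1, h3, Pi.smul_apply, h4, smul_eq_mul, ← displacementFun_displacementFun]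
  simp only [Function.comp_apply] at h2
  unfold displacementFun at h2 ⊢
  rw [h2]

theorem displacement_neg_displacement (ξ : ℂ) (ψ : Mode) :
    displacement (-ξ) (displacement ξ ψ) = ψ := by
  rw [displacement_displacement]
  simp [mul_comm]

@[simp] theorem norm_displacement_apply (ξ : ℂ) (ψ : Mode) : ‖displacement ξ ψ‖ = ‖ψ‖ := by
  refine (norm_displacement_apply_le ξ ψ).antisymm ?_
  conv_lhs => rw [← displacement_neg_displacement ξ ψ]
  exact norm_displacement_apply_le _ _

theorem inner_displacement_displacement (ξ : ℂ) (φ ψ : Mode) :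
    inner ℂ (displacement ξ φ) (displacement ξ ψ) = inner ℂ φ ψ :=
  (LinearMap.norm_map_iff_inner_map_map (displacement ξ)).1 (norm_displacement_apply ξ) φ ψ

theorem inner_displacement_left (ξ : ℂ) (φ ψ : Mode) :
    inner ℂ (displacement ξ φ) ψ = inner ℂ φ (displacement (-ξ) ψ) := by
  rw [← inner_displacement_displacement (-ξ), displacement_neg_displacement]

theorem norm_inner_displacement_le (ξ : ℂ) (φ ψ : Mode) :
    ‖(inner ℂ (displacement ξ φ) ψ : ℂ)‖ ≤ ‖φ‖ * ‖ψ‖ := by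
  simpa using norm_inner_le_norm (𝕜 := ℂ) (displacement ξ φ) ψ

/-- Conjugation of a displacement by another one produces a phase. -/
theorem inner_displacement_conj (α ξ : ℂ) (φ ψ : Mode) :
    inner ℂ (displacement ξ (displacement α φ)) (displacement α ψ) =
      exp (α * conj ξ - conj α * ξ) * inner ℂ (displacement ξ φ) ψ := by
  have h : displacement ξ (displacement α φ) =
      exp (ξ * conj α - conj ξ * α) • displacement α (displacement ξ φ) := by
    rw [displacement_displacement, displacement_displacement, smul_smul, ← Complex.exp_add,
      add_comm α]
    congr 2
    ring
  rw [h, inner_smul_left, inner_displacement_displacement, ← Complex.exp_conj]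
  congr 2
  simp
  ring

theorem norm_exp_phase (ξ ζ : ℂ) : ‖exp ((ξ * conj ζ - conj ξ * ζ) / 2)‖ = 1 := by
  have h : (ξ * conj ζ - conj ξ * ζ) / 2 = ((ξ.im * ζ.re - ξ.re * ζ.im : ℝ) : ℂ) * I := by
    apply Complex.ext <;> (simp; try ring)
  rw [h, norm_exp_ofReal_mul_I]

/-- For real argument the displacement is a pure translation, and translations act strongly
continuously on L². -/
theorem continuous_displacement_ofReal (φ : Mode) :
    Continuous fun q : ℝ => displacement (q : ℂ) φ := by
  let T : ℝ → C(ℝ, ℝ) := fun q => ⟨fun x => x - √2 * q, by fun_prop⟩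
  have hT : Continuous T :=
    ContinuousMap.continuous_of_continuous_uncurry _ (by
      simp only [Function.uncurry_def]; change Continuous fun p : ℝ × ℝ => p.2 - √2 * p.1
      fun_prop)
  have hm : ∀ q, MeasurePreserving (T q) volume volume := fun q =>
    measurePreserving_sub_right volume (√2 * q)
  have := (continuous_const (y := φ)).compMeasurePreservingLp hT hm
    (by norm_num : (2 : ENNReal) ≠ ⊤)
  refine this.congr fun q => ?_
  apply Lp.ext
  filter_upwards [Lp.coeFn_compMeasurePreserving φ (hm q), coeFn_displacement q φ] with x h1 h2
  rw [h1, h2]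
  simp [displacementFun, T]

/-- For imaginary argument the displacement multiplies by a character, so dominated convergence
applies. -/
theorem continuous_inner_displacement_mul_I (φ ψ : Mode) :
    Continuous fun y : ℝ => (inner ℂ (displacement ((y : ℂ) * I) φ) ψ : ℂ) := by
  have h : ∀ y : ℝ, (inner ℂ (displacement ((y : ℂ) * I) φ) ψ : ℂ) =
      ∫ x : ℝ, exp (-(I * ((√2 * y * x : ℝ) : ℂ))) * inner ℂ (φ x) (ψ x) := by
    intro y
    rw [L2.inner_def]
    apply integral_congr_ae
    filter_upwards [coeFn_displacement ((y : ℂ) * I) φ] with x hx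
    rw [hx]
    simp only [displacementFun, RCLike.inner_apply, map_mul, ← Complex.exp_conj]
    simp
    ring
  simp_rw [h]
  refine continuous_of_dominated (bound := fun x => ‖(inner ℂ (φ x) (ψ x) : ℂ)‖) (fun y => ?_)
    (fun y => ?_) (L2.integrable_inner φ ψ).norm ?_
  · exact Continuous.aestronglyMeasurable (by fun_prop) |>.mul (L2.integrable_inner φ ψ).1
  · refine Filter.Eventually.of_forall fun x => ?_
    rw [norm_mul, ← mul_neg, ← ofReal_neg, mul_comm I, norm_exp_ofReal_mul_I, one_mul]
  · refine Filter.Eventually.of_forall fun x => ?_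
    fun_prop

theorem continuous_inner_of_weak_of_strong {X : Type*} [TopologicalSpace X] {A B : X → Mode} {C : ℝ}
    (hA : ∀ χ, Continuous fun x => (inner ℂ (A x) χ : ℂ)) (hC : ∀ x, ‖A x‖ ≤ C)
    (hB : Continuous B) : Continuous fun x => (inner ℂ (A x) (B x) : ℂ) := by
  rw [continuous_iff_continuousAt]
  intro x₀
  have h1 : Filter.Tendsto (fun x => (inner ℂ (A x) (B x - B x₀) : ℂ)) (nhds x₀) (nhds 0) := by
    have h2 : Filter.Tendsto (fun x => C * ‖B x - B x₀‖) (nhds x₀) (nhds 0) := by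
      have : Continuous fun x => C * ‖B x - B x₀‖ := by fun_prop
      simpa using this.tendsto x₀
    refine squeeze_zero_norm (fun x => (norm_inner_le_norm _ _).trans ?_) h2
    gcongr
    exact hC x
  have h3 := h1.add ((hA (B x₀)).tendsto x₀)
  simpa [← inner_add_right, ContinuousAt] using h3

/-- Up to a continuous phase, D(ξ) factors into a translation and a modulation. Moving the
translation to the other side of the inner product leaves one strongly continuous and one bounded
weakly continuous factor. -/
theorem continuous_inner_displacement (φ ψ : Mode) :
    Continuous fun ξ : ℂ => (inner ℂ (displacement ξ φ) ψ : ℂ) := by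
  have h : ∀ ξ : ℂ, (inner ℂ (displacement ξ φ) ψ : ℂ) = exp (-(I * (ξ.re * ξ.im : ℝ))) *
        inner ℂ (displacement (ξ.im * I) φ) (displacement ((-ξ.re : ℝ) : ℂ) ψ) := by
    intro ξ
    have h1 := displacement_displacement (ξ.re : ℂ) (ξ.im * I) φ
    rw [re_add_im] at h1
    have h2 : (inner ℂ (displacement (ξ.im * I) φ) (displacement ((-ξ.re : ℝ) : ℂ) ψ) : ℂ) =
        exp (I * (ξ.re * ξ.im : ℝ)) * inner ℂ (displacement ξ φ) ψ := by
      rw [ofReal_neg, ← inner_displacement_left, h1, inner_smul_left, ← Complex.exp_conj]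
      have : conj (2 : ℂ) = 2 := map_ofNat _ 2
      congr 2
      simp [this]
      ring
    rw [h2, ← mul_assoc, ← Complex.exp_add, neg_add_cancel, Complex.exp_zero, one_mul]
  simp_rw [h]
  refine Continuous.mul (by fun_prop) ?_
  refine continuous_inner_of_weak_of_strong (C := ‖φ‖)
    (fun χ => (continuous_inner_displacement_mul_I φ χ).comp continuous_im)
    (fun x => (norm_displacement_apply_le _ _)) ?_
  exact (continuous_displacement_ofReal ψ).comp continuous_re.neg

end PhaseSpace

/-! ### Plancherel for the Fourier integral -/

open MeasureTheory FourierTransform SchwartzMap in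
/-- Plancherel's theorem for functions in `L¹ ∩ L²`. -/
theorem MeasureTheory.MemLp.eLpNorm_fourier_eq {g : ℝ → ℂ} (h1 : Integrable g) (h2 : MemLp g 2) :
    eLpNorm (𝓕 g) 2 = eLpNorm g 2 := by
  set G : Lp ℂ 2 (volume : Measure ℝ) := h2.toLp g with hG
  have hcont : Continuous (𝓕 g) :=
    VectorFourier.fourierIntegral_continuous Real.continuous_fourierChar
      (by exact continuous_inner) h1
  -- The L² Fourier transform and the Fourier integral agree as tempered distributions; hence they
  -- agree almost everywhere, and the L² isometry transfers.
  have key : ∀ φ : 𝓢(ℝ, ℂ), ∫ x, φ x • ((𝓕 G : Lp ℂ 2 (volume : Measure ℝ)) x) =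
      ∫ x, φ x • 𝓕 g x := by
    intro φ
    have e1 := congrArg (fun T => T φ) (Lp.fourier_toTemperedDistribution_eq G)
    simp only [TemperedDistribution.fourier_apply, Lp.toTemperedDistribution_apply] at e1
    rw [← e1]
    have e2 := VectorFourier.integral_fourierIntegral_smul_eq_flip (μ := (volume : Measure ℝ))
        (ν := volume) (L := innerₗ ℝ) (f := φ) (g := g) Real.continuous_fourierChar
        (by exact continuous_inner) φ.integrable h1
    have e3 : ∫ x, φ x • 𝓕 g x = ∫ x, (𝓕 φ) x • g x := by
      rw [flip_innerₗ] at e2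
      exact e2.symm
    rw [e3]
    apply integral_congr_ae
    filter_upwards [h2.coeFn_toLp] with x hx
    rw [hG, hx]
  have hae : (𝓕 G : Lp ℂ 2 (volume : Measure ℝ)) =ᵐ[volume] 𝓕 g := by
    have hl1 : LocallyIntegrable (𝓕 G : Lp ℂ 2 (volume : Measure ℝ)) volume :=
      (Lp.memLp _).locallyIntegrable (by norm_num)
    refine ae_eq_of_integral_contDiff_smul_eq hl1 hcont.locallyIntegrable fun f hf hfc => ?_
    let φ : 𝓢(ℝ, ℂ) := HasCompactSupport.toSchwartzMap (f := fun x => (f x : ℂ))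
      (hfc.comp_left (g := fun x : ℝ => (x : ℂ)) (by simp))
      (Complex.ofRealCLM.contDiff.comp hf)
    have := key φ
    have hφ : ∀ x, φ x = (f x : ℂ) := fun x => rfl
    simpa only [hφ, smul_eq_mul, Complex.real_smul] using this
  rw [← eLpNorm_congr_ae hae, ← eLpNorm_congr_ae h2.coeFn_toLp]
  have := Lp.norm_fourier_eq G
  rw [Lp.norm_def, Lp.norm_def, ENNReal.toReal_eq_toReal_iff' (Lp.eLpNorm_ne_top _)
      (Lp.eLpNorm_ne_top _)] at this
  exact this

/-! ### Orthogonality relations for matrix coefficients -/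

namespace PhaseSpace
open MeasureTheory Complex ComplexConjugate

/-- At fixed real part q, the coefficient is a phase times a rescaled Fourier transform in the
imaginary part, so Plancherel computes its L² norm in y. -/
theorem inner_displacement_eq_fourier (φ ψ : Mode) (q y : ℝ) :
    (inner ℂ (displacement (q + y * I) φ) ψ : ℂ) =
      exp (I * (q * y : ℝ)) * FourierTransform.fourier (fun x : ℝ => conj (φ (x - √2 * q)) *
          ψ x) (y / (√2 * Real.pi)) := by
  rw [L2.inner_def, Real.fourier_real_eq_integral_exp_smul, ← integral_const_mul]
  apply integral_congr_ae
  filter_upwards [coeFn_displacement (q + y * I) φ] with x hx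
  rw [hx]
  have hp : (Real.pi : ℂ) ≠ 0 := by exact_mod_cast Real.pi_ne_zero
  have h2 : ((√2 : ℝ) : ℂ) ≠ 0 := by simp
  have hs : ((√2 : ℝ) : ℂ) ^ 2 = 2 := by
    rw [← ofReal_pow, Real.sq_sqrt (by norm_num)]; norm_num
  simp only [displacementFun, RCLike.inner_apply, map_mul, ← Complex.exp_conj, smul_eq_mul]
  rw [← mul_assoc, mul_comm (ψ x), mul_assoc, mul_comm (ψ x), ← mul_assoc, ← mul_assoc,
      ← mul_assoc, ← Complex.exp_add]
  congr 2
  · congr 1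
    simp
    field_simp
    linear_combination (-x * y) * hs
  · simp

theorem eLpNorm_two_sq {X : Type*} [MeasurableSpace X] (μ : Measure X) {E : Type*} [ENorm E]
    (f : X → E) :
    eLpNorm f 2 μ ^ 2 = ∫⁻ x, ‖f x‖ₑ ^ 2 ∂μ := by
  rw [eLpNorm_eq_lintegral_rpow_enorm_toReal two_ne_zero ENNReal.ofNat_ne_top,
      ← ENNReal.rpow_natCast,
    ← ENNReal.rpow_mul]
  simp

theorem lintegral_comp_const_mul {f : ℝ → ENNReal} (hf : Measurable f) {a : ℝ} (ha : a ≠ 0) :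
    ∫⁻ x, f (a * x) = ENNReal.ofReal |a⁻¹| * ∫⁻ x, f x := by
  rw [← lintegral_map hf (measurable_const_mul a), Real.map_volume_mul_left ha,
      lintegral_smul_measure,
    smul_eq_mul]

theorem lintegral_enorm_sq_eq (φ : Mode) : ∫⁻ x, ‖φ x‖ₑ ^ 2 = ‖φ‖ₑ ^ 2 := by
  rw [← eLpNorm_two_sq, Lp.enorm_def]

/-- The orthogonality relation of the displacement operators. -/
theorem lintegral_enorm_inner_displacement (φ ψ : Mode) :
    ∫⁻ ξ : ℂ, ‖(inner ℂ (displacement ξ φ) ψ : ℂ)‖ₑ ^ 2 =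
      ENNReal.ofReal Real.pi * ‖φ‖ₑ ^ 2 * ‖ψ‖ₑ ^ 2 := by
  have hφ : Measurable φ := (Lp.stronglyMeasurable φ).measurable
  have hψ : Measurable ψ := (Lp.stronglyMeasurable ψ).measurable
  have h2 : (√2 : ℝ) ≠ 0 := by simp
  have hsub : ∀ q : ℝ, Measurable fun x : ℝ => φ (x - √2 * q) := fun q =>
    hφ.comp (measurable_id.sub_const _)
  have hmeas : Measurable fun p : ℝ × ℝ => ‖conj (φ (p.2 - √2 * p.1)) * ψ p.2‖ₑ ^ 2 := by
    have h1 : Measurable fun p : ℝ × ℝ => φ (p.2 - √2 * p.1) :=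
      hφ.comp (by fun_prop)
    exact (((Complex.continuous_conj.measurable.comp h1).mul
      (hψ.comp measurable_snd)).enorm).pow_const 2
  -- Integrating over q first decouples φ from ψ; the Jacobian of x − √2 q gives 1/√2, which later
  -- combines with √2 π to give π.
  have hJ : ∫⁻ q : ℝ, ∫⁻ x : ℝ, ‖conj (φ (x - √2 * q)) * ψ x‖ₑ ^ 2 =
      ENNReal.ofReal (√2)⁻¹ * ‖φ‖ₑ ^ 2 * ‖ψ‖ₑ ^ 2 := by
    rw [lintegral_lintegral_swap hmeas.aemeasurable]
    have : ∀ x : ℝ, ∫⁻ q : ℝ, ‖conj (φ (x - √2 * q)) * ψ x‖ₑ ^ 2 =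
        ENNReal.ofReal (√2)⁻¹ * ‖φ‖ₑ ^ 2 * ‖ψ x‖ₑ ^ 2 := by
      intro x
      have hmx : Measurable fun u : ℝ => ‖φ (x - u)‖ₑ ^ 2 :=
        (hφ.comp (measurable_id.const_sub x)).enorm.pow_const 2
      simp_rw [enorm_mul, mul_pow, RCLike.enorm_conj]
      have hmq : Measurable fun q : ℝ => ‖φ (x - √2 * q)‖ₑ ^ 2 :=
        hmx.comp (measurable_const_mul √2)
      rw [lintegral_mul_const _ hmq,
        lintegral_comp_const_mul hmx h2, lintegral_sub_left_eq_self (fun u => ‖φ u‖ₑ ^ 2),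
        lintegral_enorm_sq_eq, abs_of_pos (by positivity)]
    simp_rw [this]
    rw [lintegral_const_mul _ (hψ.enorm.pow_const 2), lintegral_enorm_sq_eq]
  have hy : ∀ᵐ q : ℝ, ∫⁻ y : ℝ, ‖(inner ℂ (displacement (q + y * I) φ) ψ : ℂ)‖ₑ ^ 2 =
      ENNReal.ofReal (√2 * Real.pi) * ∫⁻ x : ℝ, ‖conj (φ (x - √2 * q)) * ψ x‖ₑ ^ 2 := by
    have hm : Measurable fun q : ℝ => ∫⁻ x : ℝ, ‖conj (φ (x - √2 * q)) * ψ x‖ₑ ^ 2 := by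
      exact hmeas.lintegral_prod_right
    -- Finiteness of the double integral puts the slice in L² for almost every q only, which
    -- suffices.
    have hlt := ae_lt_top hm (by rw [hJ]; finiteness)
    filter_upwards [hlt] with q hq
    set g : ℝ → ℂ := fun x => conj (φ (x - √2 * q)) * ψ x with hg
    have hgm : Measurable g := (Complex.continuous_conj.measurable.comp (hsub q)).mul hψ
    have hg2 : MemLp g 2 := by
      refine ⟨hgm.aestronglyMeasurable, ?_⟩
      rw [← eLpNorm_two_sq volume g] at hq
      exact lt_top_iff_ne_top.2 fun h => by
        rw [h] at hq
        simp at hq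
    have hg1 : Integrable g := by
      have hq' : MemLp (fun x : ℝ => φ (x - √2 * q)) 2 :=
        (Lp.memLp φ).comp_measurePreserving (measurePreserving_sub_right volume (√2 * q))
      exact (hq'.star).integrable_mul (Lp.memLp ψ)
    have hF : Measurable (FourierTransform.fourier g) := by
      have : Continuous (FourierTransform.fourier g) :=
        VectorFourier.fourierIntegral_continuous Real.continuous_fourierChar
          (by exact continuous_inner) hg1
      exact this.measurable
    rw [← eLpNorm_two_sq volume g, ← MemLp.eLpNorm_fourier_eq hg1 hg2, eLpNorm_two_sq]
    have hpi : (√2 * Real.pi)⁻¹ ≠ 0 := by positivity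
    have := lintegral_comp_const_mul (f := fun x => ‖FourierTransform.fourier g x‖ₑ ^ 2)
        (hF.enorm.pow_const 2) hpi
    rw [inv_inv, abs_of_pos (by positivity)] at this
    rw [← this]
    refine lintegral_congr fun y => ?_
    rw [inner_displacement_eq_fourier, enorm_mul, mul_comm I, ← div_eq_inv_mul,
      ← ofReal_norm (cexp _), norm_exp_ofReal_mul_I, ENNReal.ofReal_one, one_mul]
  have hc := continuous_inner_displacement φ ψ
  rw [← (volume_preserving_equiv_real_prod.symm).lintegral_comp_emb
    measurableEquivRealProd.symm.measurableEmbedding, Measure.volume_eq_prod, lintegral_prod]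
  · have : ∀ q y : ℝ, measurableEquivRealProd.symm (q, y) = (q + y * I : ℂ) := by
      intro q y
      rw [measurableEquivRealProd_symm_apply]
      exact Complex.mk_eq_add_mul_I q y
    simp_rw [this]
    rw [lintegral_congr_ae hy, lintegral_const_mul', hJ, ← mul_assoc, ← mul_assoc,
        ← ENNReal.ofReal_mul (by positivity)]
    · congr 3
      field_simp
    · finiteness
  · exact ((hc.measurable.enorm.pow_const 2).comp
      measurableEquivRealProd.symm.measurable).aemeasurable

theorem memLp_inner_displacement (φ ψ : Mode) :
    MemLp (fun ξ : ℂ => (inner ℂ (displacement ξ φ) ψ : ℂ)) 2 := by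
  refine ⟨(continuous_inner_displacement φ ψ).aestronglyMeasurable, ?_⟩
  have h := lintegral_enorm_inner_displacement φ ψ
  rw [← eLpNorm_two_sq] at h
  refine lt_top_iff_ne_top.2 fun h' => ?_
  rw [h', ENNReal.top_pow two_ne_zero] at h
  exact (by finiteness : ENNReal.ofReal Real.pi * ‖φ‖ₑ ^ 2 * ‖ψ‖ₑ ^ 2 ≠ ⊤) h.symm

/-- The matrix coefficient `ξ ↦ ⟨D(ξ) φ, ψ⟩` as a square-integrable function. -/
noncomputable def matrixCoeff (φ ψ : Mode) : Lp ℂ 2 (volume : Measure ℂ) :=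
  (memLp_inner_displacement φ ψ).toLp _

theorem matrixCoeff_add_left (φ₁ φ₂ ψ : Mode) :
    matrixCoeff (φ₁ + φ₂) ψ = matrixCoeff φ₁ ψ + matrixCoeff φ₂ ψ := by
  rw [matrixCoeff, matrixCoeff, matrixCoeff, ← MemLp.toLp_add]
  congr 1
  ext ξ
  simp [inner_add_left]

theorem matrixCoeff_add_right (φ ψ₁ ψ₂ : Mode) :
    matrixCoeff φ (ψ₁ + ψ₂) = matrixCoeff φ ψ₁ + matrixCoeff φ ψ₂ := by
  rw [matrixCoeff, matrixCoeff, matrixCoeff, ← MemLp.toLp_add]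
  congr 1
  ext ξ
  simp [inner_add_right]

theorem matrixCoeff_smul_left (c : ℂ) (φ ψ : Mode) :
    matrixCoeff (c • φ) ψ = conj c • matrixCoeff φ ψ := by
  rw [matrixCoeff, matrixCoeff, ← MemLp.toLp_const_smul]
  congr 1
  ext ξ
  simp [inner_smul_left]

theorem matrixCoeff_smul_right (c : ℂ) (φ ψ : Mode) :
    matrixCoeff φ (c • ψ) = c • matrixCoeff φ ψ := by
  rw [matrixCoeff, matrixCoeff, ← MemLp.toLp_const_smul]
  congr 1
  ext ξ
  simp [inner_smul_right]

theorem norm_matrixCoeff_sq (φ ψ : Mode) :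
    ‖matrixCoeff φ ψ‖ ^ 2 = Real.pi * (‖φ‖ ^ 2 * ‖ψ‖ ^ 2) := by
  have h := lintegral_enorm_inner_displacement φ ψ
  rw [← eLpNorm_two_sq, ← eLpNorm_congr_ae (memLp_inner_displacement φ ψ).coeFn_toLp,
    ← Lp.enorm_def] at h
  change ‖matrixCoeff φ ψ‖ₑ ^ 2 = _ at h
  have h2 := congrArg ENNReal.toReal h
  simpa [Real.pi_nonneg, mul_assoc] using h2

/-- Polarization of the norm identity in the second vector. -/
theorem inner_matrixCoeff_same (φ ψ₁ ψ₂ : Mode) :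
    (inner ℂ (matrixCoeff φ ψ₁) (matrixCoeff φ ψ₂) : ℂ) =
      Real.pi * (‖φ‖ ^ 2 * inner ℂ ψ₁ ψ₂) := by
  have h : ∀ a b : Mode, ‖matrixCoeff φ a + matrixCoeff φ b‖ ^ 2 =
      Real.pi * (‖φ‖ ^ 2 * ‖a + b‖ ^ 2) := fun a b => by
    rw [← matrixCoeff_add_right, norm_matrixCoeff_sq]
  have h' : ∀ a b : Mode, ‖matrixCoeff φ a - matrixCoeff φ b‖ ^ 2 =
      Real.pi * (‖φ‖ ^ 2 * ‖a - b‖ ^ 2) := fun a b => by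
    rw [sub_eq_add_neg, ← neg_one_smul ℂ (matrixCoeff φ b), ← matrixCoeff_smul_right, h,
      neg_one_smul, ← sub_eq_add_neg]
  rw [inner_eq_sum_norm_sq_div_four, inner_eq_sum_norm_sq_div_four (𝕜 := ℂ) ψ₁]
  have e : ∀ r : ℝ, ((RCLike.ofReal r : ℂ)) = (r : ℂ) := fun _ => rfl
  simp only [RCLike.I_to_complex, ← matrixCoeff_smul_right, e, ← ofReal_pow]
  rw [h, h', h, h']
  push_cast
  ring

theorem inner_matrixCoeff (φ₁ ψ₁ φ₂ ψ₂ : Mode) :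
    (inner ℂ (matrixCoeff φ₁ ψ₁) (matrixCoeff φ₂ ψ₂) : ℂ) =
      Real.pi * (inner ℂ φ₂ φ₁ * inner ℂ ψ₁ ψ₂) := by
  have h : ∀ a : Mode, (inner ℂ (matrixCoeff a ψ₁) (matrixCoeff a ψ₂) : ℂ) =
      Real.pi * (inner ℂ a a * inner ℂ ψ₁ ψ₂) := fun a => by
    rw [inner_matrixCoeff_same, inner_self_eq_norm_sq_to_K]
    rfl
  -- Polarization in the conjugate-linear slot: the vectors φ₁ + φ₂ and φ₁ + iφ₂ separate the two
  -- cross terms.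
  have h1 := h (φ₁ + φ₂)
  have h2 := h (φ₁ + I • φ₂)
  simp only [matrixCoeff_add_left, matrixCoeff_smul_left, inner_add_left, inner_add_right,
    inner_smul_left, inner_smul_right, h, conj_I, map_neg] at h1 h2
  linear_combination (h1 + I * h2) / 2 - (inner ℂ (matrixCoeff φ₂ ψ₁) (matrixCoeff φ₁ ψ₂) -
    inner ℂ (matrixCoeff φ₁ ψ₁) (matrixCoeff φ₂ ψ₂) + Real.pi * (inner ℂ φ₂ φ₁ * inner ℂ ψ₁ ψ₂)
    - Real.pi * (inner ℂ φ₁ φ₂ * inner ℂ ψ₁ ψ₂)) / 2 * I_sq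

theorem integral_conj_matrixCoeff_mul (φ₁ ψ₁ φ₂ ψ₂ : Mode) :
    ∫ ξ : ℂ, conj (inner ℂ (displacement ξ φ₁) ψ₁ : ℂ) * inner ℂ (displacement ξ φ₂) ψ₂ =
      Real.pi * (inner ℂ φ₂ φ₁ * inner ℂ ψ₁ ψ₂) := by
  rw [← inner_matrixCoeff, L2.inner_def]
  apply integral_congr_ae
  filter_upwards [(memLp_inner_displacement φ₁ ψ₁).coeFn_toLp,
    (memLp_inner_displacement φ₂ ψ₂).coeFn_toLp] with ξ h1 h2
  rw [matrixCoeff, matrixCoeff, h1, h2, RCLike.inner_apply, mul_comm]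

theorem integrable_conj_matrixCoeff_mul (φ₁ ψ₁ φ₂ ψ₂ : Mode) :
    Integrable fun ξ : ℂ =>
      conj (inner ℂ (displacement ξ φ₁) ψ₁ : ℂ) * inner ℂ (displacement ξ φ₂) ψ₂ :=
  (memLp_inner_displacement φ₁ ψ₁).star.integrable_mul (memLp_inner_displacement φ₂ ψ₂)

/-- Cauchy–Schwarz combined with the orthogonality relation; this is the domination that justifies
the exchanges of sum and integral in Weyl inversion. -/
theorem lintegral_enorm_matrixCoeff_mul_le (φ₁ ψ₁ φ₂ ψ₂ : Mode) :
    ∫⁻ ξ : ℂ, ‖conj (inner ℂ (displacement ξ φ₁) ψ₁ : ℂ) * inner ℂ (displacement ξ φ₂) ψ₂‖ₑ ≤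
      ENNReal.ofReal Real.pi * (‖φ₁‖ₑ * ‖ψ₁‖ₑ * (‖φ₂‖ₑ * ‖ψ₂‖ₑ)) := by
  simp_rw [enorm_mul, RCLike.enorm_conj]
  have hm : ∀ φ ψ : Mode, AEMeasurable fun ξ : ℂ => ‖(inner ℂ (displacement ξ φ) ψ : ℂ)‖ₑ :=
    fun φ ψ => (continuous_inner_displacement φ ψ).measurable.enorm.aemeasurable
  refine (ENNReal.lintegral_mul_le_Lp_mul_Lq volume Real.HolderConjugate.two_two (hm φ₁ ψ₁)
      (hm φ₂ ψ₂)).trans ?_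
  have h : ∀ φ ψ : Mode, (∫⁻ ξ : ℂ, ‖(inner ℂ (displacement ξ φ) ψ : ℂ)‖ₑ ^ (2 : ℝ)) ^ (1 / 2 : ℝ) =
      ENNReal.ofReal Real.pi ^ (1 / 2 : ℝ) * (‖φ‖ₑ * ‖ψ‖ₑ) := by
    intro φ ψ
    have := lintegral_enorm_inner_displacement φ ψ
    simp_rw [← ENNReal.rpow_natCast] at this
    push_cast at this
    rw [this, mul_assoc, ENNReal.mul_rpow_of_nonneg _ _ (by norm_num),
        ENNReal.mul_rpow_of_nonneg _ _ (by norm_num),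
      ← ENNReal.rpow_mul, ← ENNReal.rpow_mul]
    norm_num
  rw [h, h]
  have hp : ENNReal.ofReal Real.pi ^ (1 / 2 : ℝ) * ENNReal.ofReal Real.pi ^ (1 / 2 : ℝ) =
      ENNReal.ofReal Real.pi := by
    rw [← ENNReal.rpow_add_of_nonneg _ _ (by norm_num) (by norm_num)]
    norm_num
  conv_rhs => rw [← hp]
  apply le_of_eq
  ring

/-! ### Positive trace-class operators as sums of rank-one operators -/

section Decomposition

variable {H : Type} [NormedAddCommGroup H] [InnerProductSpace ℂ H] [CompleteSpace H]

/-- `T = ∑ᵢ |uᵢ⟩⟨uᵢ|` weakly, with `∑ᵢ ‖uᵢ‖²` finite. -/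
def IsRankOneSum {ι : Type} (T : H →L[ℂ] H) (u : ι → H) : Prop :=
  (Summable fun i => ‖u i‖ ^ 2) ∧
    ∀ φ ψ, HasSum (fun i => inner ℂ φ (u i) * inner ℂ (u i) ψ) (inner ℂ φ (T ψ))

theorem exists_selfAdjoint_sqrt {T : H →L[ℂ] H} (hT : T.IsPositive) :
    ∃ S : H →L[ℂ] H, (∀ x y, inner ℂ (S x) y = (inner ℂ x (S y) : ℂ)) ∧ ∀ x, S (S x) = T x := by
  have hT0 : (0 : H →L[ℂ] H) ≤ T := (ContinuousLinearMap.nonneg_iff_isPositive T).2 hT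
  have hS : IsSelfAdjoint (CFC.sqrt T) := (CFC.sqrt_nonneg T).isSelfAdjoint
  refine ⟨CFC.sqrt T, fun x y => ?_, fun x => ?_⟩
  · rw [← ContinuousLinearMap.adjoint_inner_left, hS.adjoint_eq]
  · conv_rhs => rw [← CFC.sqrt_mul_sqrt_self T hT0]
    rfl

/-- Take uᵢ = √T eᵢ for a Hilbert basis (eᵢ) and apply Parseval. -/
theorem IsPosTraceClass.exists_isRankOneSum {T : H →L[ℂ] H} (hT : IsPosTraceClass T) :
    ∃ (ι : Type) (_ : Countable ι) (u : ι → H), IsRankOneSum T u := by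
  obtain ⟨S, hS, hSS⟩ := exists_selfAdjoint_sqrt hT.1
  set e := stdBasis H
  have hs : Summable fun i => ‖S (e i)‖ ^ 2 := by
    have h : Summable fun i => (inner ℂ (e i) (T (e i)) : ℂ) := hT.2
    have h2 : ∀ i, (inner ℂ (e i) (T (e i)) : ℂ) = ((‖S (e i)‖ ^ 2 : ℝ) : ℂ) := fun i => by
      rw [← hSS, ← hS, inner_self_eq_norm_sq_to_K]
      norm_cast
    simp_rw [h2] at h
    exact Complex.summable_ofReal.1 h
  -- Only the nonzero vectors are kept: the support of a summable family is countable, as the later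
  -- exchange of sum and integral needs.
  refine ⟨Function.support fun i => ‖S (e i)‖ ^ 2, hs.countable_support.to_subtype,
    fun i => S (e i), hs.subtype _, fun φ ψ => ?_⟩
  have h := e.hasSum_inner_mul_inner (S φ) (S ψ)
  rw [hS, hSS] at h
  refine (hasSum_subtype_iff_of_support_subset (f := fun i => inner ℂ φ (S (e i)) * inner ℂ
      (S (e i)) ψ) ?_).2 ?_
  · intro i hi hi0
    simp at hi0
    simp [hi0] at hi
  · simpa only [hS] using h

/-- The arithmetic–geometric mean inequality reduces this to Bessel's inequality for x and for y. -/
theorem summable_norm_inner_mul_inner {H κ : Type} [NormedAddCommGroup H]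
    [InnerProductSpace ℂ H] (b : HilbertBasis κ ℂ H) (x y : H) :
    (Summable fun m => ‖(inner ℂ x (b m) * inner ℂ (b m) y : ℂ)‖) ∧
      ∑' m, ‖(inner ℂ x (b m) * inner ℂ (b m) y : ℂ)‖ ≤ (‖x‖ ^ 2 + ‖y‖ ^ 2) / 2 := by
  have hx := b.orthonormal.inner_products_summable x (𝕜 := ℂ)
  have hy := b.orthonormal.inner_products_summable y (𝕜 := ℂ)
  have hx' := b.orthonormal.tsum_inner_products_le x (𝕜 := ℂ)
  have hy' := b.orthonormal.tsum_inner_products_le y (𝕜 := ℂ)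
  have hle : ∀ m, ‖(inner ℂ x (b m) * inner ℂ (b m) y : ℂ)‖ ≤
      (‖(inner ℂ (b m) x : ℂ)‖ ^ 2 + ‖(inner ℂ (b m) y : ℂ)‖ ^ 2) / 2 := fun m => by
    rw [norm_mul, norm_inner_symm x]
    linarith [two_mul_le_add_sq ‖(inner ℂ (b m) x : ℂ)‖ ‖(inner ℂ (b m) y : ℂ)‖]
  have hs := (hx.add hy).div_const 2
  have h1 := Summable.of_nonneg_of_le (fun m => norm_nonneg _) hle hs
  refine ⟨h1, (h1.tsum_le_tsum hle hs).trans ?_⟩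
  rw [tsum_div_const, hx.tsum_add hy]
  gcongr

omit [CompleteSpace H] in
-- Both series are iterated sums of one absolutely summable double series. It serves with V a
-- displacement and W its adjoint, whose isometry bounds the i-th row by ‖uᵢ‖².
theorem IsRankOneSum.hasSum_trace_comp {ι κ : Type} {T : H →L[ℂ] H} {u : ι → H}
    (hu : IsRankOneSum T u) (b : HilbertBasis κ ℂ H) {V W : H →L[ℂ] H}
    (hVW : ∀ x y, inner ℂ x (V y) = (inner ℂ (W x) y : ℂ)) (hW : ∀ x, ‖W x‖ = ‖x‖) :
    ∃ t, HasSum (fun m => inner ℂ (b m) (T (V (b m)))) t ∧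
      HasSum (fun i => inner ℂ (u i) (V (u i))) t := by
  let F : ι × κ → ℂ := fun p => inner ℂ (W (u p.1)) (b p.2) * inner ℂ (b p.2) (u p.1)
  have hF : Summable F := by
    apply Summable.of_norm
    rw [summable_prod_of_nonneg fun p => norm_nonneg _]
    refine ⟨fun i => (summable_norm_inner_mul_inner b (W (u i)) (u i)).1, ?_⟩
    refine Summable.of_nonneg_of_le (fun i => tsum_nonneg fun m => norm_nonneg _) (fun i => ?_) hu.1
    refine (summable_norm_inner_mul_inner b (W (u i)) (u i)).2.trans ?_
    rw [hW]
    linarith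
  refine ⟨∑' p, F p, ?_, ?_⟩
  · have hF' : HasSum (fun p : κ × ι => F (p.2, p.1)) (∑' p, F p) :=
      (Equiv.prodComm κ ι).hasSum_iff.2 hF.hasSum
    refine hF'.prod_fiberwise fun m => ?_
    have h := hu.2 (b m) (V (b m))
    simp_rw [hVW, mul_comm (inner ℂ (b m) _ : ℂ)] at h
    exact h
  · refine hF.hasSum.prod_fiberwise fun i => ?_
    rw [hVW]
    exact b.hasSum_inner_mul_inner (W (u i)) (u i)

end Decomposition


/-! ### Characteristic functions and Weyl inversion -/

section CharFun

theorem IsRankOneSum.hasSum_charFun {ι : Type} {T : Mode →L[ℂ] Mode} {u : ι → Mode}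
    (hu : IsRankOneSum T u) (ξ : ℂ) :
    (Summable fun m => (inner ℂ (stdBasis Mode m) (T (displacement ξ (stdBasis Mode m))) : ℂ)) ∧
    HasSum (fun i => conj (inner ℂ (displacement ξ (u i)) (u i) : ℂ)) (charFun T ξ) := by
  obtain ⟨t, h1, h2⟩ := hu.hasSum_trace_comp (stdBasis Mode) (V := displacement ξ)
    (W := displacement (-ξ)) (fun x y => by rw [inner_displacement_left, neg_neg])
    (norm_displacement_apply _)
  have h3 : charFun T ξ = t := h1.tsum_eq
  rw [h3]
  refine ⟨h1.summable, ?_⟩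
  simpa only [inner_conj_symm] using h2

theorem summable_charFun {T : Mode →L[ℂ] Mode} (hT : T ∈ traceClass Mode) (ξ : ℂ) :
    Summable fun m => (inner ℂ (stdBasis Mode m) (T (displacement ξ (stdBasis Mode m))) : ℂ) := by
  induction hT using Submodule.span_induction with
  | mem T hT =>
    obtain ⟨ι, _, u, hu⟩ := IsPosTraceClass.exists_isRankOneSum hT
    exact (hu.hasSum_charFun ξ).1
  | zero => simp
  | add S T _ _ hS hT => simpa [inner_add_right] using hS.add hT
  | smul a T _ hT => simpa [inner_smul_right] using hT.mul_left a

theorem charFun_add {S T : Mode →L[ℂ] Mode} (hS : S ∈ traceClass Mode) (hT : T ∈ traceClass Mode)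
    (ξ : ℂ) : charFun (S + T) ξ = charFun S ξ + charFun T ξ := by
  have := (summable_charFun hS ξ).tsum_add (summable_charFun hT ξ)
  simpa [charFun, trace, inner_add_right] using this

theorem charFun_smul (a : ℂ) (T : Mode →L[ℂ] Mode) (ξ : ℂ) :
    charFun (a • T) ξ = a * charFun T ξ := by
  simp [charFun, trace, tsum_mul_left]

theorem charFun_zero_right (T : Mode →L[ℂ] Mode) : charFun T 0 = trace T := by
  simp [charFun]

theorem IsRankOneSum.continuous_charFun {ι : Type} {T : Mode →L[ℂ] Mode} {u : ι → Mode}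
    (hu : IsRankOneSum T u) : Continuous (charFun T) := by
  have h : charFun T = fun ξ => ∑' i, conj (inner ℂ (displacement ξ (u i)) (u i) : ℂ) :=
    funext fun ξ => (hu.hasSum_charFun ξ).2.tsum_eq.symm
  rw [h]
  refine continuous_tsum (fun i => Complex.continuous_conj.comp
      (continuous_inner_displacement _ _)) hu.1
    fun i ξ => ?_
  rw [RCLike.norm_conj, sq]
  exact norm_inner_displacement_le _ _ _

theorem IsRankOneSum.lintegral_enorm_charFun_mul_le {ι : Type} [Countable ι] {T : Mode →L[ℂ] Mode}
    {u : ι → Mode} (hu : IsRankOneSum T u) (φ ψ : Mode) :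
    ∫⁻ ξ, ‖charFun T ξ * inner ℂ (displacement ξ φ) ψ‖ₑ ≤
      ENNReal.ofReal (Real.pi * ∑' i, ‖u i‖ ^ 2) * (‖φ‖ₑ * ‖ψ‖ₑ) := by
  calc ∫⁻ ξ, ‖charFun T ξ * inner ℂ (displacement ξ φ) ψ‖ₑ
      ≤ ∫⁻ ξ, ∑' i, ‖conj (inner ℂ (displacement ξ (u i)) (u i) : ℂ) *
          inner ℂ (displacement ξ φ) ψ‖ₑ := by
        refine lintegral_mono fun ξ => ?_
        have h := (hu.hasSum_charFun ξ).2.mul_right (inner ℂ (displacement ξ φ) ψ : ℂ)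
        rw [← h.tsum_eq]
        exact enorm_tsum_le_tsum_enorm
    _ = ∑' i, ∫⁻ ξ, ‖conj (inner ℂ (displacement ξ (u i)) (u i) : ℂ) *
          inner ℂ (displacement ξ φ) ψ‖ₑ :=
        lintegral_tsum fun i => (integrable_conj_matrixCoeff_mul _ _ _ _).1.enorm
    _ ≤ ∑' i, ENNReal.ofReal Real.pi * (‖u i‖ₑ * ‖u i‖ₑ * (‖φ‖ₑ * ‖ψ‖ₑ)) :=
        ENNReal.tsum_le_tsum fun i => lintegral_enorm_matrixCoeff_mul_le _ _ _ _
    _ = _ := by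
        rw [ENNReal.tsum_mul_left, ENNReal.tsum_mul_right, ← mul_assoc,
          ENNReal.ofReal_mul Real.pi_nonneg, ENNReal.ofReal_tsum_of_nonneg
              (fun i => by positivity) hu.1]
        congr 3
        ext i
        rw [ENNReal.ofReal_pow (norm_nonneg _), ofReal_norm, sq]

/-- Weyl inversion: a trace-class operator is the Weyl transform of its characteristic function. -/
theorem IsRankOneSum.weyl_inversion {ι : Type} [Countable ι] {T : Mode →L[ℂ] Mode}
    {u : ι → Mode} (hu : IsRankOneSum T u) (φ ψ : Mode) :
    (Integrable fun ξ => charFun T ξ * inner ℂ (displacement ξ φ) ψ) ∧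
    ∫ ξ, charFun T ξ * inner ℂ (displacement ξ φ) ψ = Real.pi * inner ℂ φ (T ψ) := by
  refine ⟨⟨(hu.continuous_charFun.mul (continuous_inner_displacement φ ψ)).aestronglyMeasurable,
    (hu.lintegral_enorm_charFun_mul_le φ ψ).trans_lt (by finiteness)⟩, ?_⟩
  have hs : Summable fun i => ∫ ξ, ‖conj (inner ℂ (displacement ξ (u i)) (u i) : ℂ) *
          inner ℂ (displacement ξ φ) ψ‖ := by
    refine Summable.of_nonneg_of_le (fun i => integral_nonneg fun ξ => norm_nonneg _) (fun i => ?_)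
      ((hu.1.mul_left Real.pi).mul_right (‖φ‖ * ‖ψ‖))
    have h := lintegral_enorm_matrixCoeff_mul_le (u i) (u i) φ ψ
    rw [integral_norm_eq_lintegral_enorm (integrable_conj_matrixCoeff_mul _ _ _ _).1]
    have h2 := ENNReal.toReal_mono (by finiteness) h
    refine h2.trans (le_of_eq ?_)
    simp [Real.pi_nonneg]
    ring
  -- For each rank-one term the inversion formula is the polarized orthogonality relation.
  have h := hasSum_integral_of_summable_integral_norm
    (fun i => integrable_conj_matrixCoeff_mul (u i) (u i) φ ψ) hs
  have h2 := (hu.2 φ ψ).mul_left (Real.pi : ℂ)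
  simp_rw [integral_conj_matrixCoeff_mul] at h
  rw [h2.unique h]
  refine integral_congr_ae (Filter.Eventually.of_forall fun ξ => ?_)
  exact ((hu.hasSum_charFun ξ).2.mul_right _).tsum_eq.symm

theorem weyl_inversion {T : Mode →L[ℂ] Mode} (hT : T ∈ traceClass Mode) (φ ψ : Mode) :
    (Integrable fun ξ => charFun T ξ * inner ℂ (displacement ξ φ) ψ) ∧
    ∫ ξ, charFun T ξ * inner ℂ (displacement ξ φ) ψ = Real.pi * inner ℂ φ (T ψ) := by
  induction hT using Submodule.span_induction with
  | mem T hT =>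
    obtain ⟨ι, _, u, hu⟩ := IsPosTraceClass.exists_isRankOneSum hT
    exact hu.weyl_inversion φ ψ
  | zero => simp [charFun, trace]
  | add S T hS' hT' hS hT =>
    simp_rw [charFun_add hS' hT', add_mul]
    refine ⟨hS.1.add hT.1, ?_⟩
    rw [integral_add hS.1 hT.1, hS.2, hT.2]
    simp [inner_add_right, mul_add]
  | smul a T _ hT =>
    simp_rw [charFun_smul, mul_assoc]
    refine ⟨hT.1.const_mul a, ?_⟩
    rw [integral_const_mul, hT.2]
    simp [inner_smul_right]
    ring

theorem continuous_charFun {T : Mode →L[ℂ] Mode} (hT : T ∈ traceClass Mode) :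
    Continuous (charFun T) := by
  induction hT using Submodule.span_induction with
  | mem T hT =>
    obtain ⟨ι, _, u, hu⟩ := IsPosTraceClass.exists_isRankOneSum hT
    exact hu.continuous_charFun
  | zero =>
    have : charFun 0 = fun _ => 0 := by funext ξ; simp [charFun, trace]
    rw [this]
    exact continuous_const
  | add S T hS' hT' hS hT =>
    rw [funext (charFun_add hS' hT')]
    exact hS.add hT
  | smul a T _ hT =>
    rw [funext (charFun_smul a T)]
    exact continuous_const.mul hT

/-- A trace-class operator is determined by its characteristic function. -/
theorem eq_of_charFun_eq {S T : Mode →L[ℂ] Mode} (hS : S ∈ traceClass Mode)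
    (hT : T ∈ traceClass Mode) (h : ∀ ξ, charFun S ξ = charFun T ξ) : S = T := by
  ext1 ψ
  refine ext_inner_left ℂ fun φ => ?_
  have h1 := (weyl_inversion hS φ ψ).2
  simp_rw [h, (weyl_inversion hT φ ψ).2] at h1
  exact (mul_left_cancel₀ (by exact_mod_cast Real.pi_ne_zero) h1).symm

end CharFun

/-! ### Integrals of positive definite functions -/

section PositiveDefinite

open ProbabilityTheory in
theorem measurePreserving_pi_pair {X : Type*} [MeasurableSpace X] (μ : Measure X)
    [IsProbabilityMeasure μ] {n : ℕ} {j k : Fin n} (hjk : j ≠ k) :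
    MeasurePreserving (fun x : Fin n → X => (x j, x k)) (Measure.pi fun _ => μ) (μ.prod μ) := by
  refine ⟨by fun_prop, ?_⟩
  have hind := (iIndepFun_pi (μ := fun _ : Fin n => μ) (X := fun _ x => x)
    fun _ => aemeasurable_id).indepFun hjk
  rw [indepFun_iff_map_prod_eq_prod_map_map (measurable_pi_apply j).aemeasurable
    (measurable_pi_apply k).aemeasurable] at hind
  rw [hind, (measurePreserving_eval (fun _ : Fin n => μ) j).map_eq,
    (measurePreserving_eval (fun _ : Fin n => μ) k).map_eq]

/-- A bounded positive semidefinite kernel has nonnegative double integral against every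
probability measure: average its quadratic form over independent sample points. -/
theorem integral_prod_nonneg_of_psd {X : Type*} [MeasurableSpace X] (μ : Measure X)
    [IsProbabilityMeasure μ] {K : X × X → ℝ} (hK : Measurable K) {C : ℝ} (hC : ∀ p, |K p| ≤ C)
    (hpos : ∀ (n : ℕ) (x : Fin n → X), 0 ≤ ∑ j, ∑ k, K (x j, x k)) :
    0 ≤ ∫ p, K p ∂(μ.prod μ) := by
  set A := ∫ p, K p ∂(μ.prod μ) with hA
  set B := ∫ x, K (x, x) ∂μ with hB
  have hint : ∀ (n : ℕ) (j k : Fin n),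
      Integrable (fun x : Fin n → X => K (x j, x k)) (Measure.pi fun _ => μ) := fun n j k =>
    Integrable.of_bound (hK.comp (by fun_prop)).aestronglyMeasurable C
      (Filter.Eventually.of_forall fun x => hC _)
  have hval : ∀ (n : ℕ) (j k : Fin n),
      ∫ x : Fin n → X, K (x j, x k) ∂(Measure.pi fun _ => μ) = if j = k then B else A := by
    intro n j k
    split_ifs with hjk
    · subst hjk
      have hm := measurePreserving_eval (fun _ : Fin n => μ) j
      have := integral_map (f := fun x => K (x, x)) hm.measurable.aemeasurable
        (by rw [hm.map_eq]; exact (hK.comp (by fun_prop)).aestronglyMeasurable)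
      rw [hm.map_eq] at this
      exact this.symm
    · have hm := measurePreserving_pi_pair μ hjk
      have := integral_map (f := K) hm.measurable.aemeasurable
        (by rw [hm.map_eq]; exact hK.aestronglyMeasurable)
      rw [hm.map_eq] at this
      exact this.symm
  -- A sample of n points has n diagonal terms of mean B and n(n − 1) off-diagonal terms of mean A;
  -- for large n the latter dominate, so A < 0 is impossible.
  have hn : ∀ n : ℕ, 0 ≤ (n : ℝ) * B + n * (n - 1) * A := by
    intro n
    have h : 0 ≤ ∫ x : Fin n → X, ∑ j, ∑ k, K (x j, x k) ∂(Measure.pi fun _ => μ) :=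
      integral_nonneg fun x => hpos n x
    rw [integral_finsetSum _ fun j _ => integrable_finsetSum _ fun k _ => hint n j k] at h
    simp_rw [integral_finsetSum _ fun k _ => hint n _ k, hval] at h
    have h2 : ∀ j : Fin n, ∑ k, (if j = k then B else A) = B - A + n * A := by
      intro j
      have : ∀ k, (if j = k then B else A) = (if j = k then B - A else 0) + A := by
        intro k; split_ifs <;> ring
      simp_rw [this, Finset.sum_add_distrib]
      simp
    simp_rw [h2] at h
    simp at h
    linarith
  by_contra hneg
  push Not at hneg
  obtain ⟨n, hnlt⟩ := exists_nat_gt (|B| / (-A) + 1)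
  have h1 : |B| < (n - 1) * (-A) := by
    rw [← div_lt_iff₀ (by linarith)]
    linarith
  have hn0 : (0 : ℝ) < n := by
    have := div_nonneg (abs_nonneg B) (by linarith : 0 ≤ -A)
    linarith
  have h2 := hn n
  have h3 : (n : ℝ) * B + n * (n - 1) * A = n * (B - (n - 1) * (-A)) := by ring
  rw [h3] at h2
  have h4 : B - (n - 1) * (-A) < 0 := by linarith [le_abs_self B]
  nlinarith

theorem integral_rexp_neg_mul_norm_sq {b : ℝ} (hb : 0 < b) :
    ∫ x : ℂ, Real.exp (-b * ‖x‖ ^ 2) = Real.pi / b := by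
  rw [GaussianFourier.integral_rexp_neg_mul_sq_norm hb, Complex.finrank_real_complex]
  norm_num

theorem integrable_rexp_neg_mul_norm_sq {b : ℝ} (hb : 0 < b) :
    Integrable fun x : ℂ => Real.exp (-b * ‖x‖ ^ 2) := by
  refine Integrable.of_integral_ne_zero ?_
  rw [integral_rexp_neg_mul_norm_sq hb]
  positivity

theorem integral_cexp_neg_mul_norm_sq_add_phase {b : ℝ} (hb : 0 < b) (ξ : ℂ) :
    ∫ α : ℂ, (Real.exp (-b * ‖α‖ ^ 2) : ℂ) * exp (α * conj ξ - conj α * ξ) =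
      (Real.pi / b * Real.exp (-‖ξ‖ ^ 2 / b) : ℝ) := by
  have h := GaussianFourier.integral_cexp_neg_mul_sq_norm_add (V := ℂ) (b := b) (by simpa using hb)
    (2 * I) (I * ξ)
  have h1 : ∀ α : ℂ, (Real.exp (-b * ‖α‖ ^ 2) : ℂ) * exp (α * conj ξ - conj α * ξ) =
      exp (-b * ‖α‖ ^ 2 + 2 * I * (inner ℝ (I * ξ) α : ℝ)) := by
    intro α
    rw [ofReal_exp, ← Complex.exp_add]
    congr 1
    push_cast
    congr 1
    rw [Complex.inner]
    apply Complex.ext <;> (simp; try ring)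
  simp_rw [h1]
  rw [h, Complex.finrank_real_complex]
  have hb' : (b : ℂ) ≠ 0 := by exact_mod_cast hb.ne'
  push_cast
  rw [div_self two_ne_zero, cpow_one]
  congr 2
  rw [norm_mul, norm_I, one_mul, mul_pow, I_sq]
  field_simp
  ring

theorem integral_convolution_gaussian {h : ℂ → ℝ} (hi : Integrable h) {b : ℝ} (hb : 0 < b) :
    ∫ y : ℂ, ∫ x : ℂ, h (x - y) * Real.exp (-b * ‖x‖ ^ 2) * Real.exp (-b * ‖y‖ ^ 2) =
      Real.pi / (2 * b) * ∫ u : ℂ, h u * Real.exp (-(b / 2) * ‖u‖ ^ 2) := by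
  have hg := integrable_rexp_neg_mul_norm_sq hb
  have h1 : ∀ y : ℂ, ∫ x : ℂ, h (x - y) * Real.exp (-b * ‖x‖ ^ 2) * Real.exp (-b * ‖y‖ ^ 2) =
      ∫ u : ℂ, h u * Real.exp (-b * ‖u + y‖ ^ 2) * Real.exp (-b * ‖y‖ ^ 2) := fun y => by
    rw [← integral_add_right_eq_self _ y]
    simp
  simp_rw [h1]
  rw [integral_integral_swap]
  · rw [← integral_const_mul]
    congr 1
    ext u
    -- Completing the square: |u + y|² + |y|² = |u|²/2 + 2|y + u/2|².
    have h2 : ∀ y : ℂ, h u * Real.exp (-b * ‖u + y‖ ^ 2) * Real.exp (-b * ‖y‖ ^ 2) =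
        h u * Real.exp (-(b / 2) * ‖u‖ ^ 2) * Real.exp (-(2 * b) * ‖y + u / 2‖ ^ 2) := fun y => by
      rw [mul_assoc, mul_assoc, ← Real.exp_add, ← Real.exp_add]
      congr 2
      simp only [← Complex.normSq_eq_norm_sq, Complex.normSq_apply]
      simp
      ring
    simp_rw [h2]
    rw [integral_const_mul, integral_add_right_eq_self (fun y : ℂ => Real.exp (-(2 * b) *
        ‖y‖ ^ 2)) (u / 2),
      integral_rexp_neg_mul_norm_sq (by linarith)]
    ring
  · have h3 : Integrable (fun p : ℂ × ℂ => Real.exp (-b * ‖p.1‖ ^ 2) * h p.2)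
        (volume.prod volume) :=
      hg.mul_prod hi
    refine (h3.bdd_mul (c := 1) (f := fun p : ℂ × ℂ => Real.exp (-b * ‖p.2 +
        p.1‖ ^ 2)) ?_ ?_).congr ?_
    · exact Continuous.aestronglyMeasurable (by fun_prop)
    · refine Filter.Eventually.of_forall fun p => ?_
      rw [Real.norm_eq_abs, Real.abs_exp, Real.exp_le_one_iff]
      have : 0 ≤ b * ‖p.2 + p.1‖ ^ 2 := by positivity
      linarith
    · refine Filter.Eventually.of_forall fun p => ?_
      simp only [Function.uncurry]
      ring

/-- Sampling both points from a centred Gaussian probability measure shows that ∫ h(u) exp(−b|u|²/2)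
is nonnegative; then b → 0. Unweighted sums suffice because the weights are produced by the sampling
measure. -/
theorem integral_nonneg_of_positiveDefinite {h : ℂ → ℝ} (hc : Continuous h) (hi : Integrable h)
    {C : ℝ} (hC : ∀ ξ, |h ξ| ≤ C)
    (hpos : ∀ (n : ℕ) (ξ : Fin n → ℂ), 0 ≤ ∑ j, ∑ k, h (ξ j - ξ k)) :
    0 ≤ ∫ ξ, h ξ := by
  have key : ∀ b : ℝ, 0 < b → 0 ≤ ∫ u : ℂ, h u * Real.exp (-(b / 2) * ‖u‖ ^ 2) := by
    intro b hb
    have hg := integrable_rexp_neg_mul_norm_sq hb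
    let g : ℂ → ℝ := fun x => b / Real.pi * Real.exp (-b * ‖x‖ ^ 2)
    have hg0 : ∀ x, 0 ≤ g x := fun x => by
      have := Real.pi_pos
      positivity
    have hgm : Measurable fun x => ENNReal.ofReal (g x) := by
      have : Continuous g := by fun_prop
      exact this.measurable.ennreal_ofReal
    let μ : Measure ℂ := volume.withDensity fun x => ENNReal.ofReal (g x)
    have hμ : IsProbabilityMeasure μ := ⟨by
      rw [withDensity_apply _ MeasurableSet.univ, Measure.restrict_univ,
        ← ofReal_integral_eq_lintegral_ofReal (hg.const_mul _) (Filter.Eventually.of_forall hg0),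
        integral_const_mul, integral_rexp_neg_mul_norm_sq hb]
      have := Real.pi_pos
      field_simp
      simp⟩
    have hint : ∀ f : ℂ → ℝ, ∫ x, f x ∂μ = ∫ x, g x * f x := fun f => by
      rw [integral_withDensity_eq_integral_toReal_smul hgm (by simp)]
      simp [ENNReal.toReal_ofReal (hg0 _)]
    have hsub : Continuous fun p : ℂ × ℂ => h (p.1 - p.2) := by fun_prop
    have h0 := integral_prod_nonneg_of_psd μ (K := fun p => h (p.1 - p.2)) hsub.measurable
      (fun p => hC _) hpos
    rw [integral_prod_symm _ (Integrable.of_bound hsub.aestronglyMeasurable C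
      (Filter.Eventually.of_forall fun p => hC _))] at h0
    simp_rw [hint, ← integral_const_mul] at h0
    have e : ∀ x y : ℂ, g y * (g x * h (x - y)) = (b / Real.pi) ^ 2 *
        (h (x - y) * Real.exp (-b * ‖x‖ ^ 2) * Real.exp (-b * ‖y‖ ^ 2)) := fun x y => by
      simp only [g]; ring
    simp_rw [e, integral_const_mul] at h0
    rw [integral_convolution_gaussian hi hb, ← mul_assoc] at h0
    have := Real.pi_pos
    exact nonneg_of_mul_nonneg_right h0 (by positivity)
  have hlim : Filter.Tendsto (fun n : ℕ => ∫ u : ℂ, h u * Real.exp (-((1 / ((n : ℝ) + 1)) / 2) *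
      ‖u‖ ^ 2))
      Filter.atTop (nhds (∫ u, h u)) := by
    refine tendsto_integral_of_dominated_convergence (fun u => |h u|) (fun n => ?_) hi.abs
      (fun n => ?_) ?_
    · exact Continuous.aestronglyMeasurable (by fun_prop)
    · refine Filter.Eventually.of_forall fun u => ?_
      rw [norm_mul, Real.norm_eq_abs, Real.norm_eq_abs, Real.abs_exp]
      refine mul_le_of_le_one_right (abs_nonneg _) (Real.exp_le_one_iff.2 ?_)
      have : 0 ≤ ((1 / ((n : ℝ) + 1)) / 2) * ‖u‖ ^ 2 := by positivity
      linarith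
    · refine Filter.Eventually.of_forall fun u => ?_
      have h1 : Filter.Tendsto (fun n : ℕ => 1 / ((n : ℝ) + 1)) Filter.atTop (nhds 0) :=
        tendsto_one_div_add_atTop_nhds_zero_nat
      have h2 : Continuous fun t : ℝ => h u * Real.exp (-(t / 2) * ‖u‖ ^ 2) := by fun_prop
      have h3 := (h2.tendsto 0).comp h1
      simpa [Function.comp_def] using h3
  exact ge_of_tendsto' hlim fun n => key _ (by positivity)

end PositiveDefinite

/-! ### Squeezed Gaussian wave functions -/

section Gaussian

theorem memLp_gaussian {s : ℝ} (hs : 0 < s) :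
    MemLp (fun x : ℝ => (Real.exp (-(s / 2) * x ^ 2) : ℂ)) 2 := by
  rw [memLp_two_iff_integrable_sq_norm (Continuous.aestronglyMeasurable (by fun_prop))]
  refine (integrable_exp_neg_mul_sq hs).congr (Filter.Eventually.of_forall fun x => ?_)
  simp only [norm_real, Real.norm_eq_abs, Real.abs_exp]
  rw [← Real.exp_nat_mul]
  congr 1
  push_cast
  ring

/-- The wave function `exp (-s x² / 2)`. -/
noncomputable def gaussianMode (s : ℝ) (hs : 0 < s) : Mode := (memLp_gaussian hs).toLp _

theorem inner_displacement_gaussianMode (s : ℝ) (hs : 0 < s) (ξ : ℂ) :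
    inner ℂ (displacement ξ (gaussianMode s hs)) (gaussianMode s hs) =
      ((√(Real.pi / s) * Real.exp (-(s * ξ.re ^ 2 + ξ.im ^ 2 / s) / 2) : ℝ) : ℂ) := by
  have hg := (memLp_gaussian hs).coeFn_toLp
  have hg' := (measurePreserving_sub_right volume
    (√2 * ξ.re)).quasiMeasurePreserving.ae_eq_comp hg
  have h2 : ((√2 : ℝ) : ℂ) ^ 2 = 2 := by
    rw [← ofReal_pow, Real.sq_sqrt (by norm_num)]; norm_num
  have hs' : (s : ℂ) ≠ 0 := by exact_mod_cast hs.ne'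
  have hint : (inner ℂ (displacement ξ (gaussianMode s hs)) (gaussianMode s hs) : ℂ) =
      ∫ x : ℝ, exp (-(s : ℂ) * x ^ 2 + (√2 * (s * ξ.re - I * ξ.im)) * x +
        (I * (ξ.re * ξ.im) - s * ξ.re ^ 2)) := by
    rw [L2.inner_def]
    apply integral_congr_ae
    filter_upwards [coeFn_displacement ξ (gaussianMode s hs), hg, hg'] with x h3 h4 h5
    simp only [Function.comp_apply] at h5
    rw [h3, displacementFun]
    unfold gaussianMode
    rw [h4, h5]
    simp only [RCLike.inner_apply, map_mul, ← Complex.exp_conj, ofReal_exp]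
    rw [← Complex.exp_add, ← Complex.exp_add]
    have hc2 : conj (2 : ℂ) = 2 := map_ofNat _ 2
    congr 1
    simp [hc2]
    linear_combination (- s * ξ.re ^ 2 / 2) * h2
  rw [hint, integral_cexp_quadratic (by simpa using hs)]
  push_cast
  congr 1
  · rw [Real.sqrt_eq_rpow, ofReal_cpow (by have := Real.pi_pos; positivity)]
    push_cast
    simp
  · congr 1
    field_simp
    linear_combination 2 * (s ^ 2 * ξ.re ^ 2 + I ^ 2 * ξ.im ^ 2 - 2 * s * ξ.re * I * ξ.im) * h2 +
      4 * ξ.im ^ 2 * I_sq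

end Gaussian

/-! ### Weyl transforms: existence, injectivity, trace -/

section WeylTransform

theorem inner_displacement_gaussianMode_one (ξ : ℂ) :
    inner ℂ (displacement ξ (gaussianMode 1 one_pos)) (gaussianMode 1 one_pos) =
      ((√Real.pi * Real.exp (-(1 / 2) * ‖ξ‖ ^ 2) : ℝ) : ℂ) := by
  rw [inner_displacement_gaussianMode, ← Complex.normSq_eq_norm_sq, Complex.normSq_apply]
  congr 4
  · simp
  · ring

theorem norm_gaussianMode_one_sq : ‖gaussianMode 1 one_pos‖ ^ 2 = √Real.pi := by
  have h := inner_displacement_gaussianMode_one 0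
  rw [displacement_zero, ContinuousLinearMap.id_apply, inner_self_eq_norm_sq_to_K] at h
  have h2 : ((‖gaussianMode 1 one_pos‖ ^ 2 : ℝ) : ℂ) = ((√Real.pi : ℝ) : ℂ) := by
    simpa using h
  exact_mod_cast h2

/-- `R` is the Weyl transform of `F`: `⟨φ, R ψ⟩ = π⁻¹ ∫ F(ξ) ⟨D(ξ) φ, ψ⟩ d²ξ`. -/
def IsWeylTransform (F : ℂ → ℂ) (R : Mode →L[ℂ] Mode) : Prop :=
  ∀ φ ψ : Mode, (Integrable fun ξ => F ξ * inner ℂ (displacement ξ φ) ψ) ∧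
    ∫ ξ, F ξ * inner ℂ (displacement ξ φ) ψ = Real.pi * inner ℂ φ (R ψ)

/-- The integral is a bounded sesquilinear form in (φ, ψ), hence represented by an operator. -/
theorem exists_isWeylTransform {F : ℂ → ℂ} (hF : Continuous F) {C : ℝ} (hC : 0 ≤ C)
    (hb : ∀ φ ψ : Mode, ∫⁻ ξ, ‖F ξ * inner ℂ (displacement ξ φ) ψ‖ₑ ≤
      ENNReal.ofReal C * (‖φ‖ₑ * ‖ψ‖ₑ)) : ∃ R, IsWeylTransform F R := by
  have hi : ∀ φ ψ : Mode, Integrable fun ξ => F ξ * inner ℂ (displacement ξ φ) ψ := fun φ ψ =>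
    ⟨(hF.mul (continuous_inner_displacement φ ψ)).aestronglyMeasurable,
      (hb φ ψ).trans_lt (by finiteness)⟩
  have hnorm : ∀ φ ψ : Mode, ‖∫ ξ, F ξ * inner ℂ (displacement ξ φ) ψ‖ ≤ C * ‖φ‖ * ‖ψ‖ := by
    intro φ ψ
    refine (norm_integral_le_integral_norm _).trans ?_
    rw [integral_norm_eq_lintegral_enorm (hi φ ψ).1]
    refine (ENNReal.toReal_mono (by finiteness) (hb φ ψ)).trans (le_of_eq ?_)
    simp [hC, mul_assoc]
  let B : Mode →L⋆[ℂ] Mode →L[ℂ] ℂ := LinearMap.mkContinuous₂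
    (LinearMap.mk₂'ₛₗ (starRingEnd ℂ) (RingHom.id ℂ)
      (fun φ ψ : Mode => ∫ ξ, F ξ * (inner ℂ (displacement ξ φ) ψ : ℂ))
      (fun φ₁ φ₂ ψ => by
        rw [← integral_add (hi _ _) (hi _ _)]
        simp [inner_add_left, mul_add])
      (fun c φ ψ => by
        rw [smul_eq_mul, ← integral_const_mul]
        simp [inner_smul_left, mul_left_comm])
      (fun φ ψ₁ ψ₂ => by
        rw [← integral_add (hi _ _) (hi _ _)]
        simp [inner_add_right, mul_add])
      (fun c φ ψ => by
        rw [RingHom.id_apply, smul_eq_mul, ← integral_const_mul]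
        simp [inner_smul_right, mul_left_comm])) C hnorm
  -- `continuousLinearMapOfBilin` places its operator on the left of the inner product, hence the
  -- adjoint.
  refine ⟨((Real.pi : ℂ)⁻¹) • ContinuousLinearMap.adjoint
    (InnerProductSpace.continuousLinearMapOfBilin B), fun φ ψ => ⟨hi φ ψ, ?_⟩⟩
  have hpi : (Real.pi : ℂ) ≠ 0 := by exact_mod_cast Real.pi_ne_zero
  rw [smul_apply, inner_smul_right, mul_inv_cancel_left₀ hpi,
    ContinuousLinearMap.adjoint_inner_right, InnerProductSpace.continuousLinearMapOfBilin_apply]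
  rfl

/-- Conjugating D(ξ) by D(α) costs only a phase, so coherent-state expectations of R are the
symplectic Fourier transform of F times a Gaussian. -/
theorem IsWeylTransform.coherent {F : ℂ → ℂ} {R : Mode →L[ℂ] Mode} (h : IsWeylTransform F R)
    (α : ℂ) :
    ∫ ξ, F ξ * Real.exp (-(1 / 2) * ‖ξ‖ ^ 2) * exp (α * conj ξ - conj α * ξ) =
      (√Real.pi : ℝ) * inner ℂ (displacement α (gaussianMode 1 one_pos))
        (R (displacement α (gaussianMode 1 one_pos))) := by
  have h1 := (h (displacement α (gaussianMode 1 one_pos))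
      (displacement α (gaussianMode 1 one_pos))).2
  simp_rw [inner_displacement_conj, inner_displacement_gaussianMode_one] at h1
  have h2 : ∀ ξ : ℂ, F ξ * (exp (α * conj ξ - conj α * ξ) *
      ((√Real.pi * Real.exp (-(1 / 2) * ‖ξ‖ ^ 2) : ℝ) : ℂ)) = (√Real.pi : ℝ) *
      (F ξ * Real.exp (-(1 / 2) * ‖ξ‖ ^ 2) * exp (α * conj ξ - conj α * ξ)) := fun ξ => by
    push_cast; ring
  simp_rw [h2] at h1
  rw [integral_const_mul] at h1
  have h3 : ((√Real.pi : ℝ) : ℂ) * (√Real.pi : ℝ) = Real.pi := by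
    rw [← ofReal_mul, Real.mul_self_sqrt Real.pi_nonneg]
  have h4 : ((√Real.pi : ℝ) : ℂ) ≠ 0 := by
    have := Real.pi_pos
    exact_mod_cast (by positivity : √Real.pi ≠ 0)
  apply mul_left_cancel₀ h4
  rw [h1, ← mul_assoc, h3]

theorem phase_eq_inner (α ξ : ℂ) :
    α * conj ξ - conj α * ξ = 2 * I * (inner ℝ (I * ξ) α : ℝ) := by
  rw [Complex.inner]
  apply Complex.ext <;> (simp; try ring)

theorem norm_exp_sub_conj (α ξ : ℂ) : ‖exp (α * conj ξ - conj α * ξ)‖ = 1 := by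
  have h : α * conj ξ - conj α * ξ = ((2 * inner ℝ (I * ξ) α : ℝ) : ℂ) * I := by
    rw [phase_eq_inner]; push_cast; ring
  rw [h, norm_exp_ofReal_mul_I]

/-- A function whose Weyl transform vanishes is zero. -/
theorem eq_zero_of_isWeylTransform_zero {G : ℂ → ℂ} (hc : Continuous G) (h : IsWeylTransform G 0) :
    G = 0 := by
  let K : ℂ → ℂ := fun ξ => G ξ * Real.exp (-(1 / 2) * ‖ξ‖ ^ 2)
  have hKc : Continuous K := by fun_prop
  have h4 : ((√Real.pi : ℝ) : ℂ) ≠ 0 := by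
    have := Real.pi_pos
    exact_mod_cast (by positivity : √Real.pi ≠ 0)
  have hKi : Integrable K := by
    have h1 := (h (gaussianMode 1 one_pos) (gaussianMode 1 one_pos)).1
    simp_rw [inner_displacement_gaussianMode_one] at h1
    refine (h1.const_mul ((√Real.pi : ℝ) : ℂ)⁻¹).congr (Filter.Eventually.of_forall fun ξ => ?_)
    simp only [K]
    push_cast
    field_simp
  have hF : FourierTransform.fourier K = 0 := by
    ext w
    -- The choice α = −πiw turns the symplectic phase into exp(−2πi⟨ξ, w⟩), the kernel of
    -- `FourierTransform.fourier`; vanishing coherent expectations then kill the Fourier transform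
    -- of K.
    have h1 := h.coherent (-Real.pi * I * w)
    simp only [zero_apply, inner_zero_right, mul_zero] at h1
    rw [Real.fourier_eq', Pi.zero_apply, ← h1]
    congr 1
    ext ξ
    rw [smul_eq_mul, mul_comm, phase_eq_inner]
    congr 2
    simp only [Complex.inner]
    apply Complex.ext <;> (simp; try ring)
  have hK0 := hKc.fourierInv_fourier_eq hKi (by rw [hF]; exact integrable_zero _ _ _)
  rw [hF] at hK0
  have hK1 : K = 0 := by
    rw [← hK0]
    ext w
    simp [Real.fourierInv_eq']
  ext ξ
  have := congrFun hK1 ξ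
  simpa [K] using this

theorem isWeylTransform_charFun {T : Mode →L[ℂ] Mode} (hT : T ∈ traceClass Mode) :
    IsWeylTransform (charFun T) T := weyl_inversion hT

theorem IsWeylTransform.charFun_eq {F : ℂ → ℂ} {R : Mode →L[ℂ] Mode} (h : IsWeylTransform F R)
    (hF : Continuous F) (hR : R ∈ traceClass Mode) : charFun R = F := by
  have h2 := isWeylTransform_charFun hR
  have h3 : IsWeylTransform (charFun R - F) 0 := fun φ ψ => by
    simp only [Pi.sub_apply, sub_mul]
    refine ⟨(h2 φ ψ).1.sub (h φ ψ).1, ?_⟩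
    rw [integral_sub (h2 φ ψ).1 (h φ ψ).1, (h2 φ ψ).2, (h φ ψ).2]
    simp
  exact sub_eq_zero.1 (eq_zero_of_isWeylTransform_zero ((continuous_charFun hR).sub hF) h3)

/-- After exchanging the integrals, the α-integral becomes (π/b) exp(−|ξ|²/b), of total mass π² for
every b. The bound is therefore uniform in b, and the regularization can be removed afterwards. -/
theorem IsWeylTransform.integral_husimi {F : ℂ → ℂ} {R : Mode →L[ℂ] Mode} (h : IsWeylTransform F R)
    (hF : Continuous F) {C : ℝ} (hC : ∀ ξ, ‖F ξ‖ ≤ C) {b : ℝ} (hb : 0 < b) :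
    (Integrable fun α : ℂ => (Real.exp (-b * ‖α‖ ^ 2) : ℂ) * inner ℂ
        (displacement α (gaussianMode 1 one_pos))
        (R (displacement α (gaussianMode 1 one_pos)))) ∧
    ‖∫ α : ℂ, (Real.exp (-b * ‖α‖ ^ 2) : ℂ) * inner ℂ (displacement α (gaussianMode 1 one_pos))
        (R (displacement α (gaussianMode 1 one_pos)))‖ ≤ C * (Real.pi * √Real.pi) := by
  have hpi := Real.pi_pos
  set g := gaussianMode 1 one_pos
  let J : ℂ × ℂ → ℂ := fun p => (Real.exp (-b * ‖p.1‖ ^ 2) : ℂ) * (F p.2 * Real.exp (-(1 / 2) *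
      ‖p.2‖ ^ 2) *
    exp (p.1 * conj p.2 - conj p.1 * p.2))
  have hJ : Integrable J (volume.prod volume) := by
    have h1 := ((integrable_rexp_neg_mul_norm_sq hb).mul_prod
      ((integrable_rexp_neg_mul_norm_sq (b := 1 / 2) (by norm_num)).const_mul C))
    refine h1.mono' (Continuous.aestronglyMeasurable (by fun_prop))
        (Filter.Eventually.of_forall fun p => ?_)
    rw [norm_mul, norm_mul, norm_mul, norm_exp_sub_conj, mul_one, norm_real, norm_real,
        Real.norm_eq_abs, Real.norm_eq_abs, Real.abs_exp, Real.abs_exp]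
    gcongr
    exact hC _
  have h4 : ((√Real.pi : ℝ) : ℂ) ≠ 0 := by
    exact_mod_cast (by positivity : √Real.pi ≠ 0)
  have hQ : ∀ α : ℂ, (Real.exp (-b * ‖α‖ ^ 2) : ℂ) * inner ℂ (displacement α g)
      (R (displacement α g)) =
      ((√Real.pi : ℝ) : ℂ)⁻¹ * ∫ ξ, J (α, ξ) := fun α => by
    simp only [J]
    rw [integral_const_mul, h.coherent, mul_left_comm, inv_mul_cancel_left₀ h4]
  simp_rw [hQ]
  refine ⟨hJ.integral_prod_left.const_mul _, ?_⟩
  rw [integral_const_mul, integral_integral_swap hJ, norm_mul]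
  have h5 : ∀ ξ, ∫ α, J (α, ξ) = F ξ * Real.exp (-(1 / 2) * ‖ξ‖ ^ 2) *
      (Real.pi / b * Real.exp (-‖ξ‖ ^ 2 / b) : ℝ) := fun ξ => by
    rw [← integral_cexp_neg_mul_norm_sq_add_phase hb, ← integral_const_mul]
    congr 1
    ext α
    simp only [J]
    ring
  simp_rw [h5]
  have h6 : ‖∫ ξ, F ξ * Real.exp (-(1 / 2) * ‖ξ‖ ^ 2) * (Real.pi / b *
      Real.exp (-‖ξ‖ ^ 2 / b) : ℝ)‖ ≤
      ∫ ξ : ℂ, C * (Real.pi / b) * Real.exp (-b⁻¹ * ‖ξ‖ ^ 2) := by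
    refine norm_integral_le_of_norm_le ((integrable_rexp_neg_mul_norm_sq
        (by positivity)).const_mul _)
      (Filter.Eventually.of_forall fun ξ => ?_)
    rw [norm_mul, norm_mul, norm_real, norm_real, Real.norm_eq_abs, Real.norm_eq_abs, Real.abs_exp,
      abs_of_pos (by positivity), ← mul_assoc]
    have h7 : -‖ξ‖ ^ 2 / b = -b⁻¹ * ‖ξ‖ ^ 2 := by field_simp
    rw [h7]
    have h8 : Real.exp (-(1 / 2) * ‖ξ‖ ^ 2) ≤ 1 := Real.exp_le_one_iff.2
        (by nlinarith [sq_nonneg ‖ξ‖])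
    have h9 : ‖F ξ‖ * Real.exp (-(1 / 2) * ‖ξ‖ ^ 2) ≤ C := by
      nlinarith [hC ξ, norm_nonneg (F ξ), Real.exp_pos (-(1 / 2) * ‖ξ‖ ^ 2)]
    gcongr
  rw [integral_const_mul, integral_rexp_neg_mul_norm_sq (by positivity)] at h6
  rw [norm_inv, norm_real, Real.norm_eq_abs, abs_of_pos (by positivity)]
  refine (mul_le_mul_of_nonneg_left h6 (by positivity)).trans (le_of_eq ?_)
  field_simp
  rw [Real.sq_sqrt hpi.le, mul_comm]

/-- Coherent states resolve the identity: the orthogonality relation writes each ‖√R eᵢ‖² as a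
multiple of ∫ |⟨D(α)g, √R eᵢ⟩|² dα. Bessel bounds finite sums by ‖√R D(α)g‖², the coherent-state
expectation of R, whose regularized integrals are uniformly bounded; Fatou removes the
regularization. -/
theorem IsWeylTransform.isPosTraceClass {F : ℂ → ℂ} {R : Mode →L[ℂ] Mode} (h : IsWeylTransform F R)
    (hF : Continuous F) {C : ℝ} (hC : ∀ ξ, ‖F ξ‖ ≤ C) (hR : R.IsPositive) : IsPosTraceClass R := by
  refine ⟨hR, ?_⟩
  obtain ⟨S, hS, hSS⟩ := exists_selfAdjoint_sqrt hR
  have hin : ∀ x, (inner ℂ x (R x) : ℂ) = ((‖S x‖ ^ 2 : ℝ) : ℂ) := fun x => by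
    rw [← hSS, ← hS, inner_self_eq_norm_sq_to_K]
    norm_cast
  set e := stdBasis Mode
  simp_rw [hin]
  refine Complex.summable_ofReal.2 ?_
  have hpi := Real.pi_pos
  have hC0 : 0 ≤ C := (norm_nonneg _).trans (hC 0)
  set g := gaussianMode 1 one_pos with hg
  refine summable_of_sum_le (c := C) (fun i => by positivity) fun s => ?_
  have hle : ∀ α, ∑ i ∈ s, ‖(inner ℂ (displacement α g) (S (e i)) : ℂ)‖ ^ 2 ≤
      ‖S (displacement α g)‖ ^ 2 := fun α => by
    have h1 := e.orthonormal.sum_inner_products_le (S (displacement α g)) (s := s) (𝕜 := ℂ)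
    refine le_trans (le_of_eq (Finset.sum_congr rfl fun i _ => ?_)) h1
    rw [norm_inner_symm, hS]
  have hc : ∀ i, Continuous fun α => ‖(inner ℂ (displacement α g) (S (e i)) : ℂ)‖ ^ 2 := fun i =>
    (continuous_inner_displacement g (S (e i))).norm.pow 2
  set q : ℂ → ℝ := fun α => ∑ i ∈ s, ‖(inner ℂ (displacement α g) (S (e i)) : ℂ)‖ ^ 2 with hq
  have hqc : Continuous q := continuous_finsetSum _ fun i _ => hc i
  have hq0 : ∀ α, 0 ≤ q α := fun α => Finset.sum_nonneg fun i _ => by positivity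
  have hint : ∫⁻ α, ENNReal.ofReal (q α) = ENNReal.ofReal (Real.pi * √Real.pi * ∑ i ∈ s,
      ‖S (e i)‖ ^ 2) := by
    have h1 : ∀ α, ENNReal.ofReal (q α) = ∑ i ∈ s, ‖(inner ℂ (displacement α g)
        (S (e i)) : ℂ)‖ₑ ^ 2 := by
      intro α
      rw [hq, ENNReal.ofReal_sum_of_nonneg fun i _ => by positivity]
      refine Finset.sum_congr rfl fun i _ => ?_
      rw [ENNReal.ofReal_pow (norm_nonneg _), ofReal_norm]
    simp_rw [h1]
    rw [lintegral_finsetSum _ fun i _ =>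
      ((continuous_inner_displacement g (S (e i))).measurable.enorm.pow_const 2)]
    simp_rw [lintegral_enorm_inner_displacement]
    rw [Finset.mul_sum, ENNReal.ofReal_sum_of_nonneg fun i _ => by positivity]
    refine Finset.sum_congr rfl fun i _ => ?_
    rw [ENNReal.ofReal_mul (by positivity), ENNReal.ofReal_mul hpi.le, ← norm_gaussianMode_one_sq,
      ENNReal.ofReal_pow (norm_nonneg _), ENNReal.ofReal_pow (norm_nonneg _), ofReal_norm,
          ofReal_norm]
  have hbound : ∀ n : ℕ, ∫⁻ α : ℂ, ENNReal.ofReal (Real.exp (-(1 / ((n : ℝ) + 1)) * ‖α‖ ^ 2) *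
      q α) ≤
      ENNReal.ofReal (C * (Real.pi * √Real.pi)) := by
    intro n
    obtain ⟨h1, h2⟩ := h.integral_husimi hF hC (b := 1 / ((n : ℝ) + 1)) (by positivity)
    simp_rw [← hg, hin, ← ofReal_mul] at h1 h2
    rw [integral_complex_ofReal, norm_real, Real.norm_eq_abs] at h2
    have h3 : Integrable fun α : ℂ => Real.exp (-(1 / ((n : ℝ) + 1)) * ‖α‖ ^ 2) *
        ‖S (displacement α g)‖ ^ 2 := by
      simpa only [RCLike.re_eq_complex_re, ofReal_re] using h1.re
    calc _ ≤ ∫⁻ α : ℂ, ENNReal.ofReal (Real.exp (-(1 / ((n : ℝ) + 1)) * ‖α‖ ^ 2) *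
        ‖S (displacement α g)‖ ^ 2) := by
            refine lintegral_mono fun α => ENNReal.ofReal_le_ofReal ?_
            have := hle α
            gcongr
      _ = ENNReal.ofReal (∫ α : ℂ, Real.exp (-(1 / ((n : ℝ) + 1)) * ‖α‖ ^ 2) *
          ‖S (displacement α g)‖ ^ 2) :=
            (ofReal_integral_eq_lintegral_ofReal h3
                (Filter.Eventually.of_forall fun α => by positivity)).symm
      _ ≤ _ := ENNReal.ofReal_le_ofReal ((le_abs_self _).trans h2)
  have hlim : ∀ α : ℂ, Filter.Tendsto (fun n : ℕ => ENNReal.ofReal (Real.exp (-(1 /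
      ((n : ℝ) + 1)) * ‖α‖ ^ 2) * q α))
      Filter.atTop (nhds (ENNReal.ofReal (q α))) := by
    intro α
    have h1 : Filter.Tendsto (fun n : ℕ => 1 / ((n : ℝ) + 1)) Filter.atTop (nhds 0) :=
      tendsto_one_div_add_atTop_nhds_zero_nat
    have h2 : Continuous fun t : ℝ => ENNReal.ofReal (Real.exp (-t * ‖α‖ ^ 2) * q α) :=
      ENNReal.continuous_ofReal.comp (by fun_prop)
    simpa [Function.comp_def] using (h2.tendsto 0).comp h1
  have hfin : ∫⁻ α, ENNReal.ofReal (q α) ≤ ENNReal.ofReal (C * (Real.pi * √Real.pi)) := by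
    have h1 : ∀ α, ENNReal.ofReal (q α) = Filter.liminf (fun n : ℕ => ENNReal.ofReal (Real.exp
        (-(1 / ((n : ℝ) + 1)) * ‖α‖ ^ 2) * q α)) Filter.atTop :=
      fun α => (hlim α).liminf_eq.symm
    simp_rw [h1]
    refine (lintegral_liminf_le fun n => ?_).trans ?_
    · exact (ENNReal.continuous_ofReal.comp (by fun_prop)).measurable
    · exact Filter.liminf_le_of_frequently_le' (Filter.Frequently.of_forall hbound)
  rw [hint, ENNReal.ofReal_le_ofReal_iff (by positivity)] at hfin
  have hpp : 0 < Real.pi * √Real.pi := by positivity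
  nlinarith

end WeylTransform

/-! ### Narcowich–Wigner spectrum and the quantum Bochner theorem -/

section NarcowichWigner

theorem apply_neg_of_mem_narcowichWignerSpectrum {f : ℂ → ℂ} {η : ℝ}
    (h : η ∈ narcowichWignerSpectrum f) (ξ : ℂ) : f (-ξ) = conj (f ξ) := by
  have h1 := (h 2 ![ξ, 0]).1.apply 1 0
  simp at h1
  rw [h1]

theorem norm_le_one_of_mem_narcowichWignerSpectrum {f : ℂ → ℂ} {η : ℝ}
    (h : η ∈ narcowichWignerSpectrum f) (h0 : f 0 = 1) (ξ : ℂ) : ‖f ξ‖ ≤ 1 := by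
  -- On this vector the quadratic form equals 1 − |f(ξ)|².
  have h1 := (h 2 ![ξ, 0]).dotProduct_mulVec_nonneg ![-f ξ, 1]
  simp [Matrix.mulVec, dotProduct, Fin.sum_univ_two, h0,
    apply_neg_of_mem_narcowichWignerSpectrum h] at h1
  rw [mul_comm (conj ξ) ξ, sub_self, mul_zero, Complex.exp_zero, one_mul, neg_add_cancel, mul_zero,
    add_zero, ← Complex.normSq_eq_conj_mul_self] at h1
  have h2 : normSq (f ξ) ≤ 1 := by exact_mod_cast h1
  rw [Complex.normSq_eq_norm_sq] at h2
  nlinarith [norm_nonneg (f ξ)]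

/-- Diagonal coefficients at differences form a Gram matrix up to half the phase that occurs at η =
4. -/
theorem inner_displacement_sub (ξ ζ : ℂ) (ψ : Mode) :
    inner ℂ (displacement (ξ - ζ) ψ) ψ = exp ((ξ * conj ζ - conj ξ * ζ) / 2) *
      inner ℂ (displacement ξ ψ) (displacement ζ ψ) := by
  have h := displacement_displacement (-ζ) ξ ψ
  have h2 : inner ℂ (displacement ξ ψ) (displacement ζ ψ) =
      (inner ℂ (displacement (-ζ) (displacement ξ ψ)) ψ : ℂ) := by
    rw [inner_displacement_left (-ζ), neg_neg]
  have hc2 : conj (2 : ℂ) = 2 := map_ofNat _ 2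
  rw [h2, h, inner_smul_left, ← Complex.exp_conj, ← mul_assoc, ← Complex.exp_add, neg_add_eq_sub]
  convert (one_mul _).symm
  rw [Complex.exp_eq_one_iff]
  refine ⟨0, ?_⟩
  simp [hc2]
  ring

theorem conj_inner_displacement_self (ξ : ℂ) (ψ : Mode) :
    conj (inner ℂ (displacement ξ ψ) ψ : ℂ) = inner ℂ (displacement (-ξ) ψ) ψ := by
  rw [inner_conj_symm, inner_displacement_left, neg_neg]

/-- The quadratic form of the product of a function with `4` in its Narcowich-Wigner spectrum and
the matrix coefficients of two vectors. -/
theorem sum_nonneg_of_mem_narcowichWignerSpectrum {Ω : ℂ → ℂ}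
    (h4 : (4 : ℝ) ∈ narcowichWignerSpectrum Ω) (u ψ : Mode) (n : ℕ) (ξ : Fin n → ℂ) :
    0 ≤ ∑ j, ∑ k, conj (inner ℂ (displacement (ξ j - ξ k) u) u : ℂ) * Ω (ξ j - ξ k) *
      inner ℂ (displacement (ξ j - ξ k) ψ) ψ := by
  -- Schur product of three positive semidefinite matrices. The points are negated for u because its
  -- coefficient enters conjugated; both Gram matrices then miss the same half phase, and Ω's twist
  -- supplies the two halves.
  have h := (((h4 n ξ).hadamard (Matrix.posSemidef_gram ℂ fun j => displacement (-ξ j) u)).hadamard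
    (Matrix.posSemidef_gram ℂ fun j => displacement (ξ j) ψ)).dotProduct_mulVec_nonneg 1
  simp only [dotProduct, Matrix.mulVec, Finset.mul_sum] at h
  refine h.trans (le_of_eq (Finset.sum_congr rfl fun j _ => Finset.sum_congr rfl fun k _ => ?_))
  have hp : exp ((ξ j * conj (ξ k) - conj (ξ j) * ξ k) / 2) *
      exp ((ξ j * conj (ξ k) - conj (ξ j) * ξ k) / 2) =
      exp (((4 : ℝ) : ℂ) / 4 * (ξ j * conj (ξ k) - conj (ξ j) * ξ k)) := by
    rw [← Complex.exp_add]
    congr 1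
    push_cast
    ring
  have hn : -(ξ j - ξ k) = -ξ j - -ξ k := by ring
  rw [conj_inner_displacement_self, hn, inner_displacement_sub (-ξ j), inner_displacement_sub (ξ j)]
  simp only [map_neg, neg_mul_neg]
  simp only [Pi.star_apply, Pi.one_apply, star_one, one_mul, mul_one, Matrix.hadamard_apply,
    Matrix.of_apply, Matrix.gram_apply, ← hp]
  ring

theorem IsRankOneSum.sum_charFun_nonneg {ι : Type} {T : Mode →L[ℂ] Mode} {u : ι → Mode}
    (hu : IsRankOneSum T u) {Ω : ℂ → ℂ} (h4 : (4 : ℝ) ∈ narcowichWignerSpectrum Ω) (ψ : Mode)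
    (n : ℕ) (ξ : Fin n → ℂ) :
    0 ≤ ∑ j, ∑ k, charFun T (ξ j - ξ k) * Ω (ξ j - ξ k) *
      inner ℂ (displacement (ξ j - ξ k) ψ) ψ := by
  have h : HasSum (fun i => ∑ j, ∑ k, conj (inner ℂ (displacement (ξ j - ξ k) (u i)) (u i) : ℂ) *
      Ω (ξ j - ξ k) * inner ℂ (displacement (ξ j - ξ k) ψ) ψ)
      (∑ j, ∑ k, charFun T (ξ j - ξ k) * Ω (ξ j - ξ k) *
        inner ℂ (displacement (ξ j - ξ k) ψ) ψ) :=
    hasSum_sum fun j _ => hasSum_sum fun k _ =>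
      ((hu.hasSum_charFun (ξ j - ξ k)).2.mul_right _).mul_right _
  exact h.nonneg fun i => sum_nonneg_of_mem_narcowichWignerSpectrum h4 (u i) ψ n ξ

theorem IsRankOneSum.charFun_neg {ι : Type} {T : Mode →L[ℂ] Mode} {u : ι → Mode}
    (hu : IsRankOneSum T u) (ξ : ℂ) : charFun T (-ξ) = conj (charFun T ξ) := by
  have h1 := (hu.hasSum_charFun (-ξ)).2
  have h2 := (hu.hasSum_charFun ξ).2.map (starRingEnd ℂ) Complex.continuous_conj
  refine h1.unique (h2.congr_fun fun i => ?_)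
  simp [inner_displacement_left ξ]

theorem IsRankOneSum.norm_charFun_le {ι : Type} {T : Mode →L[ℂ] Mode} {u : ι → Mode}
    (hu : IsRankOneSum T u) (ξ : ℂ) : ‖charFun T ξ‖ ≤ ∑' i, ‖u i‖ ^ 2 := by
  rw [← (hu.hasSum_charFun ξ).2.tsum_eq]
  refine tsum_of_norm_bounded hu.1.hasSum fun i => ?_
  rw [RCLike.norm_conj, sq]
  exact norm_inner_displacement_le _ _ _

/-- Quantum Bochner theorem for filtered characteristic functions. -/
theorem exists_filtered {Ω : ℂ → ℂ} (hc : Continuous Ω) (h0 : Ω 0 = 1)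
    (h4 : (4 : ℝ) ∈ narcowichWignerSpectrum Ω) {T : Mode →L[ℂ] Mode} (hT : IsPosTraceClass T) :
    ∃ R, IsPosTraceClass R ∧ ∀ ξ, charFun R ξ = charFun T ξ * Ω ξ := by
  obtain ⟨ι, _, u, hu⟩ := hT.exists_isRankOneSum
  have hΩ := norm_le_one_of_mem_narcowichWignerSpectrum h4 h0
  set C := ∑' i, ‖u i‖ ^ 2 with hC
  have hC0 : 0 ≤ C := tsum_nonneg fun i => by positivity
  let F : ℂ → ℂ := fun ξ => charFun T ξ * Ω ξ
  have hF : Continuous F := hu.continuous_charFun.mul hc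
  have hFC : ∀ ξ, ‖F ξ‖ ≤ C := fun ξ => by
    rw [norm_mul]
    exact (mul_le_of_le_one_right (norm_nonneg _) (hΩ ξ)).trans (hu.norm_charFun_le ξ)
  obtain ⟨R, hR⟩ := exists_isWeylTransform hF (C := Real.pi * C)
    (mul_nonneg Real.pi_nonneg hC0) fun φ ψ => by
      refine le_trans (lintegral_mono fun ξ => ?_) (hu.lintegral_enorm_charFun_mul_le φ ψ)
      simp only [F, enorm_mul]
      gcongr
      refine mul_le_of_le_one_right' ?_
      rw [← ofReal_norm]
      exact ENNReal.ofReal_le_one.2 (hΩ ξ)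
  have hpos : R.IsPositive := by
    rw [ContinuousLinearMap.isPositive_iff_complex]
    intro ψ
    let h : ℂ → ℂ := fun ξ => F ξ * inner ℂ (displacement ξ ψ) ψ
    have hneg : ∀ ξ, h (-ξ) = conj (h ξ) := fun ξ => by
      simp only [h, F, map_mul, conj_inner_displacement_self, hu.charFun_neg,
        apply_neg_of_mem_narcowichWignerSpectrum h4]
    have hhc : Continuous h := hF.mul (continuous_inner_displacement ψ ψ)
    have hhi : Integrable h := (hR ψ ψ).1
    have hint : ∫ ξ, h ξ = Real.pi * inner ℂ ψ (R ψ) := (hR ψ ψ).2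
    -- Hermitian symmetry of h under ξ ↦ −ξ makes its integral real, leaving only the real part to
    -- be estimated.
    have hconj : conj (∫ ξ, h ξ) = ∫ ξ, h ξ := by
      rw [← integral_conj, ← integral_neg_eq_self h]
      simp_rw [hneg]
    have hre : 0 ≤ (∫ ξ, h ξ).re := by
      have h1 : (∫ ξ, h ξ).re = ∫ ξ, (h ξ).re := (reCLM.integral_comp_comm hhi).symm
      rw [h1]
      refine integral_nonneg_of_positiveDefinite (C := C * (‖ψ‖ * ‖ψ‖))
          (continuous_re.comp hhc) hhi.re (fun ξ => ?_) fun n ξ => ?_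
      · refine (abs_re_le_norm _).trans ?_
        rw [norm_mul]
        have := norm_inner_displacement_le ξ ψ ψ
        gcongr
        exact hFC ξ
      · have h2 := hu.sum_charFun_nonneg h4 ψ n ξ
        have h3 := (Complex.le_def.1 h2).1
        simpa [h, F] using h3
    rw [hint] at hconj hre
    have hpi := Real.pi_pos
    rw [map_mul, conj_ofReal, inner_conj_symm] at hconj
    have hsym := mul_left_cancel₀ (by exact_mod_cast hpi.ne') hconj
    rw [re_ofReal_mul] at hre
    refine ⟨?_, ?_⟩
    · refine Complex.conj_eq_iff_re.1 ?_
      rw [inner_conj_symm, hsym]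
    · rw [hsym]
      exact nonneg_of_mul_nonneg_right hre hpi
  have hRt := hR.isPosTraceClass hF hFC hpos
  exact ⟨R, hRt, fun ξ => congrFun (hR.charFun_eq hF (Submodule.subset_span hRt)) ξ⟩

end NarcowichWigner

/-! ### Existence, uniqueness and positivity of the filtering map -/

section FilteringMap

variable {Ω : ℂ → ℂ}

theorem existsUnique_isFilteringMap (hc : Continuous Ω) (h0 : Ω 0 = 1)
    (h4 : (4 : ℝ) ∈ narcowichWignerSpectrum Ω) : ∃! E, IsFilteringMap Ω E := by
  have hex : ∀ T : traceClass Mode, ∃ R : traceClass Mode, ∀ ξ, charFun R ξ = charFun T ξ *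
      Ω ξ := by
    rintro ⟨T, hT⟩
    induction hT using Submodule.span_induction with
    | mem T hT =>
      obtain ⟨R, hR, h⟩ := exists_filtered hc h0 h4 hT
      exact ⟨⟨R, Submodule.subset_span hR⟩, h⟩
    | zero => exact ⟨0, fun ξ => by simp [charFun, trace]⟩
    | add S T hS hT hS' hT' =>
      obtain ⟨A, hA⟩ := hS'
      obtain ⟨B, hB⟩ := hT'
      refine ⟨A + B, fun ξ => ?_⟩
      simp only [Submodule.coe_add] at *
      rw [charFun_add A.2 B.2, charFun_add hS hT, hA, hB, add_mul]
    | smul a T hT hT' =>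
      obtain ⟨A, hA⟩ := hT'
      refine ⟨a • A, fun ξ => ?_⟩
      simp only [Submodule.coe_smul] at *
      rw [charFun_smul, charFun_smul, hA, mul_assoc]
  -- The pointwise choice is forced, hence additive and homogeneous, because characteristic
  -- functions are linear in the operator and determine it.
  choose E hE using hex
  have hext : ∀ {S T : traceClass Mode}, (∀ ξ, charFun (S : Mode →L[ℂ] Mode) ξ =
      charFun T ξ) → S = T :=
    fun {S T} h => Subtype.ext (eq_of_charFun_eq S.2 T.2 h)
  refine ⟨{ toFun := E, map_add' := fun S T => hext fun ξ => ?_, map_smul' :=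
      fun a T => hext fun ξ => ?_ },
    hE, fun E' hE' => LinearMap.ext fun T => hext fun ξ => ?_⟩
  · rw [hE, Submodule.coe_add, Submodule.coe_add, charFun_add S.2 T.2, charFun_add (E S).2
        (E T).2, hE, hE, add_mul]
  · rw [hE, RingHom.id_apply, Submodule.coe_smul, Submodule.coe_smul, charFun_smul,
        charFun_smul, hE, mul_assoc]
  · exact (hE' T ξ).trans (hE T ξ).symm

theorem IsPosTraceClass.of_isPositive {T : Mode →L[ℂ] Mode} (hT : T.IsPositive)
    (hT' : T ∈ traceClass Mode) : IsPosTraceClass T :=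
  ⟨hT, (hasSum_trace hT' (stdBasis Mode)).summable⟩

theorem IsFilteringMap.preservesDensityOperators (hc : Continuous Ω) (h0 : Ω 0 = 1)
    (h4 : (4 : ℝ) ∈ narcowichWignerSpectrum Ω) {E : traceClass Mode →ₗ[ℂ] traceClass Mode}
    (hE : IsFilteringMap Ω E) : PreservesDensityOperators E := by
  intro ρ hρ
  obtain ⟨R, hR, h⟩ := exists_filtered hc h0 h4 (IsPosTraceClass.of_isPositive hρ.1 hρ.2.1)
  have hRE : R = E ρ := eq_of_charFun_eq (Submodule.subset_span hR) (E ρ).2 fun ξ => by rw [h, hE]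
  refine ⟨hRE ▸ hR.1, (E ρ).2, ?_⟩
  rw [← charFun_zero_right, hE, charFun_zero_right, hρ.2.2, h0, one_mul]

end FilteringMap

/-! ### Complete positivity forces 0 into the spectrum -/

section CompletePositivity

open InnerProductSpace

theorem isPosTraceClass_rankOne_self (x : Mode) : IsPosTraceClass (rankOne ℂ x x) := by
  refine ⟨isPositive_rankOne_self x, ?_⟩
  have h := ((stdBasis Mode).hasSum_inner_mul_inner x x).summable
  refine h.congr fun i => ?_
  rw [rankOne_apply, inner_smul_right]

/-- Polarization into four positive rank-one operators. -/
theorem rankOne_mem_traceClass (x y : Mode) : rankOne ℂ x y ∈ traceClass Mode := by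
  have h : ∀ z : Mode, rankOne ℂ z z ∈ traceClass Mode := fun z =>
    Submodule.subset_span (isPosTraceClass_rankOne_self z)
  have e : rankOne ℂ x y = (1 / 4 : ℂ) • (rankOne ℂ (x + y) (x + y) - rankOne ℂ (x - y) (x - y) +
      I • (rankOne ℂ (x + I • y) (x + I • y) - rankOne ℂ (x - I • y) (x - I • y))) := by
    ext1 z
    simp only [rankOne_apply, smul_apply, add_apply, sub_apply, inner_add_left, inner_sub_left,
        inner_smul_left, conj_I]
    match_scalars
    · ring_nf; simp; try ring
    · ring_nf; simp; try ring
  rw [e]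
  exact (traceClass Mode).smul_mem _ ((traceClass Mode).add_mem ((traceClass Mode).sub_mem
      (h _) (h _))
    ((traceClass Mode).smul_mem _ ((traceClass Mode).sub_mem (h _) (h _))))

theorem charFun_rankOne (x y : Mode) (ξ : ℂ) :
    charFun (rankOne ℂ x y) ξ = conj (inner ℂ (displacement ξ x) y : ℂ) := by
  have h := ((stdBasis Mode).hasSum_inner_mul_inner (displacement (-ξ) y) x).tsum_eq
  rw [inner_conj_symm, ← neg_neg ξ, ← inner_displacement_left, ← h]
  unfold charFun trace
  refine tsum_congr fun i => ?_
  rw [ContinuousLinearMap.comp_apply, rankOne_apply, inner_smul_right, neg_neg,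
      inner_displacement_left, neg_neg]

theorem blockPositive_rankOne {n : ℕ} (w : Fin n → Mode) :
    BlockPositive fun j k => rankOne ℂ (w j) (w k) := by
  intro v
  have h : ∑ j, ∑ k, inner ℂ (v j) (rankOne ℂ (w j) (w k) (v k)) =
      conj (∑ k, inner ℂ (w k) (v k) : ℂ) * ∑ k, inner ℂ (w k) (v k) := by
    simp_rw [map_sum, Finset.sum_mul_sum, inner_conj_symm, rankOne_apply, inner_smul_right,
        mul_comm]
  rw [h, ← Complex.normSq_eq_conj_mul_self]
  exact_mod_cast normSq_nonneg _

/-- The phases depend only on ξ, α, β and occur once conjugated and once not, so they cancel. -/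
theorem conj_inner_mul_inner_displacement (ξ α β : ℂ) (φ χ : Mode) :
    conj (inner ℂ (displacement ξ (displacement α φ)) (displacement β φ) : ℂ) *
      inner ℂ (displacement ξ (displacement α χ)) (displacement β χ) =
    conj (inner ℂ (displacement (ξ + α - β) φ) φ : ℂ) *
      inner ℂ (displacement (ξ + α - β) χ) χ := by
  rw [displacement_displacement, displacement_displacement, inner_displacement_sub,
    inner_displacement_sub, inner_smul_left, inner_smul_left]
  have h := norm_exp_phase ξ α
  have h' := norm_exp_phase (ξ + α) β
  generalize exp ((ξ * conj α - conj ξ * α) / 2) = p at *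
  generalize exp (((ξ + α) * conj β - conj (ξ + α) * β) / 2) = q at *
  have hp : conj p * p = 1 := by
    rw [← Complex.normSq_eq_conj_mul_self, Complex.normSq_eq_norm_sq, h]; simp
  have hq : conj q * q = 1 := by
    rw [← Complex.normSq_eq_conj_mul_self, Complex.normSq_eq_norm_sq, h']; simp
  simp only [map_mul, conj_conj]
  linear_combination (conj (inner ℂ (displacement (ξ + α) φ) (displacement β φ) : ℂ) *
    inner ℂ (displacement (ξ + α) χ) (displacement β χ)) * (hp - hq)

/-- Reciprocal squeezing exchanges the two axes, so the product is isotropic. Its decay rate tends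
to infinity with s although its height stays π: its integral is π|⟨φ, χ⟩|², and the two vectors
become nearly orthogonal relative to their norms. -/
theorem conj_inner_mul_inner_gaussianMode {s : ℝ} (hs : 0 < s) (ξ : ℂ) :
    conj (inner ℂ (displacement ξ (gaussianMode s hs)) (gaussianMode s hs) : ℂ) *
      inner ℂ (displacement ξ (gaussianMode s⁻¹ (inv_pos.2 hs))) (gaussianMode s⁻¹ (inv_pos.2 hs)) =
    ((Real.pi * Real.exp (-((s + s⁻¹) / 2) * ‖ξ‖ ^ 2) : ℝ) : ℂ) := by
  have hpi := Real.pi_pos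
  rw [inner_displacement_gaussianMode, inner_displacement_gaussianMode, conj_ofReal, ← ofReal_mul,
    ← Complex.normSq_eq_norm_sq, Complex.normSq_apply]
  congr 1
  have h1 : √(Real.pi / s) * √(Real.pi / s⁻¹) = Real.pi := by
    rw [← Real.sqrt_mul (by positivity), div_inv_eq_mul, div_mul_eq_mul_div, ← mul_assoc,
        mul_div_cancel_right₀ _ hs.ne',
      Real.sqrt_mul_self hpi.le]
  rw [mul_mul_mul_comm, h1, ← Real.exp_add]
  congr 2
  field_simp
  ring

/-- Approximate identity: rescale ξ by 1/√t and use dominated convergence. -/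
theorem tendsto_gaussian_average {Ω : ℂ → ℂ} (hc : Continuous Ω) (hb : ∀ ξ, ‖Ω ξ‖ ≤ 1) (a : ℂ) :
    Filter.Tendsto (fun t : ℝ => (t : ℂ) * ∫ ξ : ℂ, Ω (ξ + a) * Real.exp (-t * ‖ξ‖ ^ 2))
      Filter.atTop (nhds (Real.pi * Ω a)) := by
  have h1 : Filter.Tendsto (fun t : ℝ => ∫ ξ : ℂ, Ω ((√t)⁻¹ • ξ + a) * Real.exp (-1 * ‖ξ‖ ^ 2))
      Filter.atTop (nhds (∫ ξ : ℂ, Ω a * Real.exp (-1 * ‖ξ‖ ^ 2))) := by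
    refine tendsto_integral_filter_of_dominated_convergence (fun ξ => Real.exp (-1 * ‖ξ‖ ^ 2))
      (Filter.Eventually.of_forall fun t => ?_) (Filter.Eventually.of_forall fun t => ?_)
      (integrable_rexp_neg_mul_norm_sq one_pos) (Filter.Eventually.of_forall fun ξ => ?_)
    · exact Continuous.aestronglyMeasurable (by fun_prop)
    · refine Filter.Eventually.of_forall fun ξ => ?_
      rw [norm_mul, norm_real, Real.norm_eq_abs, Real.abs_exp]
      exact mul_le_of_le_one_left (Real.exp_nonneg _) (hb _)
    · have h2 : Filter.Tendsto (fun t : ℝ => (√t)⁻¹) Filter.atTop (nhds 0) :=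
        tendsto_inv_atTop_zero.comp Real.tendsto_sqrt_atTop
      have h3 : Continuous fun r : ℝ => Ω (r • ξ + a) * Real.exp (-1 * ‖ξ‖ ^ 2) := by fun_prop
      simpa [Function.comp_def] using (h3.tendsto 0).comp h2
  have h4 : ∫ ξ : ℂ, Ω a * Real.exp (-1 * ‖ξ‖ ^ 2) = Real.pi * Ω a := by
    rw [integral_const_mul, integral_complex_ofReal, integral_rexp_neg_mul_norm_sq one_pos,
        div_one, mul_comm]
  rw [h4] at h1
  refine h1.congr' ?_
  filter_upwards [Filter.eventually_gt_atTop 0] with t ht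
  have h5 := Measure.integral_comp_smul (volume : Measure ℂ)
    (fun ξ : ℂ => Ω ((√t)⁻¹ • ξ + a) * Real.exp (-1 * ‖ξ‖ ^ 2)) (√t)
  have hst : √t ≠ 0 := by positivity
  simp only [smul_smul, inv_mul_cancel₀ hst, one_smul] at h5
  rw [Complex.finrank_real_complex, Real.sq_sqrt ht.le, abs_of_pos (by positivity)] at h5
  have h6 : ∀ ξ : ℂ, -1 * ‖√t • ξ‖ ^ 2 = -t * ‖ξ‖ ^ 2 := fun ξ => by
    rw [norm_smul, mul_pow, Real.norm_eq_abs, sq_abs, Real.sq_sqrt ht.le]; ring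
  simp_rw [h6] at h5
  rw [h5, Complex.real_smul, ← mul_assoc, ← ofReal_mul, mul_inv_cancel₀ ht.ne', ofReal_one, one_mul]

theorem IsFilteringMap.sum_gaussian_average_nonneg {Ω : ℂ → ℂ}
    {E : traceClass Mode →ₗ[ℂ] traceClass Mode} (hE : IsFilteringMap Ω E)
    (hcp : IsCompletelyPositive E) {s : ℝ} (hs : 0 < s) {n : ℕ} (ξ : Fin n → ℂ) (c : Fin n → ℂ) :
    0 ≤ ∑ j, ∑ k, conj (c j) * c k *
      ∫ ζ : ℂ, Ω (ζ + (ξ j - ξ k)) * Real.exp (-((s + s⁻¹) / 2) * ‖ζ‖ ^ 2) := by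
  set φ := gaussianMode s hs
  set χ := gaussianMode s⁻¹ (inv_pos.2 hs)
  have h := hcp n (fun j k => ⟨rankOne ℂ (displacement (-ξ j) φ) (displacement (-ξ k) φ),
      rankOne_mem_traceClass _ _⟩)
    (blockPositive_rankOne _) (fun j => c j • displacement (-ξ j) χ)
  refine h.trans (le_of_eq (Finset.sum_congr rfl fun j _ => Finset.sum_congr rfl fun k _ => ?_))
  rw [inner_smul_left, map_smul, inner_smul_right, ← mul_assoc]
  congr 1
  have hpi : (Real.pi : ℂ) ≠ 0 := by exact_mod_cast Real.pi_ne_zero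
  apply mul_left_cancel₀ hpi
  -- Weyl inversion expresses the matrix element as an integral; translating by ξⱼ − ξₖ recentres
  -- the Gaussian at 0 and moves the difference into Ω.
  rw [← (weyl_inversion (Subtype.mem _) _ _).2, ← integral_const_mul,
      ← integral_add_right_eq_self _ (ξ j - ξ k)]
  refine integral_congr_ae (Filter.Eventually.of_forall fun ζ => ?_)
  simp only
  rw [hE, charFun_rankOne, mul_right_comm, conj_inner_mul_inner_displacement]
  have e : ζ + (ξ j - ξ k) + -ξ j - -ξ k = ζ := by ring
  rw [e, conj_inner_mul_inner_gaussianMode hs]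
  push_cast
  ring

theorem IsFilteringMap.zero_mem_of_isCompletelyPositive {Ω : ℂ → ℂ} (hc : Continuous Ω)
    (h0 : Ω 0 = 1) {η : ℝ} (hη : η ∈ narcowichWignerSpectrum Ω)
    {E : traceClass Mode →ₗ[ℂ] traceClass Mode} (hE : IsFilteringMap Ω E)
    (hcp : IsCompletelyPositive E) : (0 : ℝ) ∈ narcowichWignerSpectrum Ω := by
  intro n ξ
  refine Matrix.PosSemidef.of_dotProduct_mulVec_nonneg ?_ fun c => ?_
  · ext j k
    simp [← apply_neg_of_mem_narcowichWignerSpectrum hη]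
  have ht : Filter.Tendsto (fun s : ℝ => (s + s⁻¹) / 2) Filter.atTop Filter.atTop := by
    refine Filter.tendsto_atTop_mono' _ ?_ (Filter.tendsto_id.atTop_div_const
      (by norm_num : (0 : ℝ) < 2))
    filter_upwards [Filter.eventually_gt_atTop 0] with s hs
    have := inv_pos.2 hs
    simp only [id]
    linarith
  have hb := norm_le_one_of_mem_narcowichWignerSpectrum hη h0
  have hlim := tendsto_finsetSum Finset.univ fun j _ => tendsto_finsetSum Finset.univ fun k _ =>
    (((tendsto_gaussian_average hc hb (ξ j - ξ k)).comp ht).const_mul (conj (c j) * c k))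
  have h1 : 0 ≤ ∑ j, ∑ k, conj (c j) * c k * (Real.pi * Ω (ξ j - ξ k)) := by
    refine ge_of_tendsto hlim ?_
    filter_upwards [Filter.eventually_gt_atTop 0] with s hs
    have h2 := hE.sum_gaussian_average_nonneg hcp hs ξ c
    have h3 : (0 : ℂ) ≤ (((s + s⁻¹) / 2 : ℝ) : ℂ) := by
      have := inv_pos.2 hs
      exact_mod_cast (by positivity : 0 ≤ (s + s⁻¹) / 2)
    refine (mul_nonneg h3 h2).trans (le_of_eq ?_)
    simp_rw [Finset.mul_sum]
    refine Finset.sum_congr rfl fun j _ => Finset.sum_congr rfl fun k _ => ?_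
    simp only [Function.comp_apply]
    ring
  have hpi : (0 : ℂ) ≤ (Real.pi : ℂ)⁻¹ := by
    exact_mod_cast inv_nonneg.2 Real.pi_nonneg
  refine (mul_nonneg hpi h1).trans (le_of_eq ?_)
  have hpi' : (Real.pi : ℂ) ≠ 0 := by exact_mod_cast Real.pi_ne_zero
  simp only [dotProduct, Matrix.mulVec, Finset.mul_sum]
  refine Finset.sum_congr rfl fun j _ => Finset.sum_congr rfl fun k _ => ?_
  simp
  field_simp

end CompletePositivity

/-! ### The example kernel -/

section ExampleKernel

theorem continuous_exampleKernel : Continuous exampleKernel := by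
  unfold exampleKernel
  fun_prop

theorem exampleKernel_zero : exampleKernel 0 = 1 := by simp [exampleKernel]

theorem hasSum_pow_mul_inv_factorial (x : ℂ) :
    HasSum (fun m : ℕ => (m.factorial : ℂ)⁻¹ * x ^ m) (exp x) := by
  have h := NormedSpace.expSeries_div_hasSum_exp (𝔸 := ℂ) x
  rw [← Complex.exp_eq_exp_ℂ] at h
  exact h.congr_fun fun m => by rw [div_eq_inv_mul]

theorem inv_factorial_succ_mul (m : ℕ) :
    ((m + 1).factorial : ℂ)⁻¹ * ((m + 1 : ℕ) : ℂ) = (m.factorial : ℂ)⁻¹ := by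
  have h1 : ((m + 1 : ℕ) : ℂ) ≠ 0 := by exact_mod_cast m.succ_ne_zero
  rw [Nat.factorial_succ, Nat.cast_mul, mul_inv, mul_right_comm, inv_mul_cancel₀ h1, one_mul]

/-- The termwise derivative of the exponential series; at m = 0 the truncated exponent is harmless
because the factor m vanishes. -/
theorem hasSum_mul_pow_sub_one (x : ℂ) :
    HasSum (fun m : ℕ => (m.factorial : ℂ)⁻¹ * m * x ^ (m - 1)) (exp x) := by
  have h : HasSum (fun m : ℕ => ((m + 1).factorial : ℂ)⁻¹ * ((m + 1 : ℕ) : ℂ) * x ^ (m + 1 - 1))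
      (exp x) := by
    simp_rw [inv_factorial_succ_mul, Nat.add_sub_cancel]
    exact hasSum_pow_mul_inv_factorial x
  have h2 := (hasSum_nat_add_iff (f := fun m : ℕ => (m.factorial : ℂ)⁻¹ * m * x ^ (m - 1)) 1).1 h
  simpa using h2

/-- The termwise derivative of the series of x exp(x). -/
theorem hasSum_sq_mul_pow_sub_one (x : ℂ) :
    HasSum (fun m : ℕ => (m.factorial : ℂ)⁻¹ * m ^ 2 * x ^ (m - 1)) ((1 + x) * exp x) := by
  have h : HasSum (fun m : ℕ => ((m + 1).factorial : ℂ)⁻¹ * ((m + 1 : ℕ) : ℂ) ^ 2 * x ^ (m + 1 - 1))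
      ((1 + x) * exp x) := by
    simp_rw [sq, ← mul_assoc, inv_factorial_succ_mul, Nat.add_sub_cancel]
    have h3 := ((hasSum_mul_pow_sub_one x).mul_left x).add (hasSum_pow_mul_inv_factorial x)
    rw [add_mul, one_mul, add_comm]
    refine h3.congr_fun fun m => ?_
    rcases m with _ | m
    · simp
    · rw [Nat.add_sub_cancel, pow_succ]
      push_cast
      ring
  have h2 := (hasSum_nat_add_iff (f := fun m : ℕ => (m.factorial : ℂ)⁻¹ * m ^ 2 * x ^
      (m - 1)) 1).1 h
  simpa using h2

theorem sum_nonneg_of_hasSum_gram {K : ℂ → ℂ → ℂ} {r : ℕ → ℝ} (hr : ∀ m, 0 ≤ r m) {b : ℕ → ℂ → ℂ}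
    (hK : ∀ z w, HasSum (fun m => (r m : ℂ) * (b m z * conj (b m w))) (K z w)) {n : ℕ}
    (z c : Fin n → ℂ) : 0 ≤ ∑ j, ∑ k, conj (c j) * K (z j) (z k) * c k := by
  have h : HasSum (fun m => ∑ j, ∑ k, conj (c j) * ((r m : ℂ) * (b m (z j) * conj
      (b m (z k)))) * c k)
      (∑ j, ∑ k, conj (c j) * K (z j) (z k) * c k) :=
    hasSum_sum fun j _ => hasSum_sum fun k _ => ((hK (z j) (z k)).mul_left _).mul_right _
  refine h.nonneg fun m => ?_
  have e : ∑ j, ∑ k, conj (c j) * ((r m : ℂ) * (b m (z j) * conj (b m (z k)))) * c k =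
      (r m : ℂ) * (conj (∑ k, conj (b m (z k)) * c k) * ∑ k, conj (b m (z k)) * c k) := by
    rw [map_sum, Finset.sum_mul_sum, Finset.mul_sum]
    refine Finset.sum_congr rfl fun j _ => ?_
    rw [Finset.mul_sum]
    refine Finset.sum_congr rfl fun k _ => ?_
    simp
    ring
  rw [e, ← Complex.normSq_eq_conj_mul_self, ← ofReal_mul]
  exact_mod_cast mul_nonneg (hr m) (normSq_nonneg _)

theorem hasSum_gram_exp (z w : ℂ) :
    HasSum (fun m : ℕ => (((m.factorial : ℝ)⁻¹ : ℝ) : ℂ) * (z ^ m * conj (w ^ m)))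
        (exp (z * conj w)) := by
  refine (hasSum_pow_mul_inv_factorial (z * conj w)).congr_fun fun m => ?_
  push_cast
  rw [map_pow, mul_pow]

/-- Up to normalization, m z^(m−1) − z* z^m is the m-th number-basis amplitude of the displaced
one-photon state, so this kernel is a Gram kernel just as the exponential is for the vacuum. -/
theorem hasSum_gram_laguerre (z w : ℂ) :
    HasSum (fun m : ℕ => (((m.factorial : ℝ)⁻¹ : ℝ) : ℂ) *
      ((m * z ^ (m - 1) - conj z * z ^ m) * conj (m * w ^ (m - 1) - conj w * w ^ m)))
      ((1 - ‖z - w‖ ^ 2) * exp (z * conj w)) := by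
  have h := (((hasSum_sq_mul_pow_sub_one (z * conj w)).sub
    ((hasSum_mul_pow_sub_one (z * conj w)).mul_left (w * conj w))).sub
    ((hasSum_mul_pow_sub_one (z * conj w)).mul_left (z * conj z))).add
    ((hasSum_pow_mul_inv_factorial (z * conj w)).mul_left (conj z * w))
  have e : (1 + z * conj w) * exp (z * conj w) - w * conj w * exp (z * conj w) -
      z * conj z * exp (z * conj w) + conj z * w * exp (z * conj w) =
      (1 - ‖z - w‖ ^ 2) * exp (z * conj w) := by
    rw [← ofReal_pow, ← Complex.normSq_eq_norm_sq, Complex.normSq_eq_conj_mul_self, map_sub]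
    ring
  rw [e] at h
  refine h.congr_fun fun m => ?_
  rcases m with _ | m
  · simp
  · simp only [Nat.add_sub_cancel, map_sub, map_mul, map_pow, conj_conj, map_natCast, mul_pow,
        pow_succ]
    push_cast
    ring

theorem four_mem_narcowichWignerSpectrum_exampleKernel :
    (4 : ℝ) ∈ narcowichWignerSpectrum exampleKernel := by
  intro n ξ
  refine Matrix.PosSemidef.of_dotProduct_mulVec_nonneg ?_ fun c => ?_
  · ext j k
    simp only [Matrix.conjTranspose_apply, Matrix.of_apply, star_def, map_mul, ← Complex.exp_conj]
    congr 1
    · rw [exampleKernel, exampleKernel, conj_ofReal, norm_sub_rev]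
    · congr 1
      simp
      ring
  -- The points √2 ξⱼ produce exp(2ξⱼξₖ*); the weights exp(−|ξⱼ|²) turn it into exp(−|ξⱼ − ξₖ|²)
  -- times the η = 4 phase.
  have h0 := sum_nonneg_of_hasSum_gram (fun m => by positivity) hasSum_gram_exp
    (fun j => √2 * ξ j) (fun j => Real.exp (-‖ξ j‖ ^ 2) * c j)
  have h1 := sum_nonneg_of_hasSum_gram (fun m => by positivity) hasSum_gram_laguerre
    (fun j => √2 * ξ j) (fun j => Real.exp (-‖ξ j‖ ^ 2) * c j)
  -- The weights come from 1 − (3/2)|ξ|² = 1/4 + (3/4)(1 − 2|ξ|²).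
  have hq : (0 : ℂ) ≤ ((1 / 4 : ℝ) : ℂ) := by exact_mod_cast (by norm_num : (0 : ℝ) ≤ 1 / 4)
  have hq' : (0 : ℂ) ≤ ((3 / 4 : ℝ) : ℂ) := by exact_mod_cast (by norm_num : (0 : ℝ) ≤ 3 / 4)
  refine (add_nonneg (mul_nonneg hq h0) (mul_nonneg hq' h1)).trans (le_of_eq ?_)
  simp only [dotProduct, Matrix.mulVec, Finset.mul_sum, ← Finset.sum_add_distrib]
  refine Finset.sum_congr rfl fun j _ => Finset.sum_congr rfl fun k _ => ?_
  have hs : ((√2 : ℝ) : ℂ) ^ 2 = 2 := by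
    rw [← ofReal_pow, Real.sq_sqrt (by norm_num)]; norm_num
  have hn : ((‖(√2 : ℂ) * ξ j - √2 * ξ k‖ : ℝ) : ℂ) ^ 2 = 2 * (‖ξ j - ξ k‖ : ℂ) ^ 2 := by
    rw [← mul_sub, norm_mul, ofReal_mul, mul_pow, norm_real, Real.norm_eq_abs,
        abs_of_pos (by positivity), hs]
  have hz : (√2 : ℂ) * ξ j * conj ((√2 : ℂ) * ξ k) = 2 * (ξ j * conj (ξ k)) := by
    rw [map_mul, conj_ofReal]
    linear_combination (ξ j * conj (ξ k)) * hs
  have he : exp (-‖ξ j - ξ k‖ ^ 2) * exp (((4 : ℝ) : ℂ) / 4 * (ξ j * conj (ξ k) - conj (ξ j) *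
      ξ k)) =
      exp (-‖ξ j‖ ^ 2) * exp (2 * (ξ j * conj (ξ k))) * exp (-‖ξ k‖ ^ 2) := by
    rw [← Complex.exp_add, ← Complex.exp_add, ← Complex.exp_add]
    congr 1
    simp only [← ofReal_pow, ← Complex.normSq_eq_norm_sq, Complex.normSq_eq_conj_mul_self, map_sub]
    push_cast
    ring
  rw [hn, hz]
  simp only [Pi.star_apply, star_def, Matrix.of_apply, exampleKernel, map_mul, conj_ofReal]
  push_cast
  linear_combination (-(conj (c j) * c k * (1 - 3 / 2 * ‖ξ j - ξ k‖ ^ 2))) * he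

theorem integral_norm_sq_mul_gaussian :
    ∫ ξ : ℂ, ‖ξ‖ ^ 2 * Real.exp (-‖ξ‖ ^ 2) = Real.pi := by
  have h := Complex.integral_rpow_mul_exp_neg_rpow (p := 2) (q := 2) (by norm_num) (by norm_num)
  norm_num [Real.rpow_two] at h
  exact h

theorem integrable_norm_sq_mul_gaussian :
    Integrable fun ξ : ℂ => ‖ξ‖ ^ 2 * Real.exp (-‖ξ‖ ^ 2) :=
  Integrable.of_integral_ne_zero (by
    rw [integral_norm_sq_mul_gaussian]
    exact Real.pi_ne_zero)

theorem ofReal_exampleKernel_re (ξ : ℂ) : ((exampleKernel ξ).re : ℂ) = exampleKernel ξ := by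
  rw [exampleKernel, ofReal_re]

theorem exampleKernel_re_eq (ξ : ℂ) : (exampleKernel ξ).re =
    Real.exp (-1 * ‖ξ‖ ^ 2) - 3 / 2 * (‖ξ‖ ^ 2 * Real.exp (-‖ξ‖ ^ 2)) := by
  rw [exampleKernel, ofReal_re, neg_one_mul]
  ring

theorem integrable_exampleKernel_re : Integrable fun ξ => (exampleKernel ξ).re := by
  simp_rw [exampleKernel_re_eq]
  exact (integrable_rexp_neg_mul_norm_sq one_pos).sub (integrable_norm_sq_mul_gaussian.const_mul _)

theorem integrable_exampleKernel : Integrable exampleKernel :=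
  integrable_exampleKernel_re.ofReal.congr (Filter.Eventually.of_forall ofReal_exampleKernel_re)

theorem integral_exampleKernel_re : ∫ ξ, (exampleKernel ξ).re = -(Real.pi / 2) := by
  simp_rw [exampleKernel_re_eq]
  rw [integral_sub (integrable_rexp_neg_mul_norm_sq one_pos)
      (integrable_norm_sq_mul_gaussian.const_mul _),
    integral_const_mul, integral_norm_sq_mul_gaussian, integral_rexp_neg_mul_norm_sq one_pos]
  ring

/-- At η = 0 there is no twist, so membership would make the kernel positive definite and its
integral −π/2 nonnegative. -/
theorem zero_notMem_narcowichWignerSpectrum_exampleKernel :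
    (0 : ℝ) ∉ narcowichWignerSpectrum exampleKernel := by
  intro h
  have h1 := integral_nonneg_of_positiveDefinite (continuous_re.comp continuous_exampleKernel)
    integrable_exampleKernel_re (C := 1)
    (fun ξ => (abs_re_le_norm _).trans
      (norm_le_one_of_mem_narcowichWignerSpectrum h exampleKernel_zero ξ)) fun n ξ => by
      have h2 := (h n ξ).dotProduct_mulVec_nonneg 1
      have h3 := (Complex.le_def.1 h2).1
      simpa [dotProduct, Matrix.mulVec] using h3
  have h2 := integral_exampleKernel_re
  simp only [Function.comp_apply] at h1
  have := Real.pi_pos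
  linarith

theorem phaseSpaceFourier_exampleKernel_im (α : ℂ) :
    (phaseSpaceFourier exampleKernel α).im = 0 := by
  rw [← Complex.conj_eq_iff_im, phaseSpaceFourier, map_mul, ← integral_conj,
    ← integral_neg_eq_self (fun ξ => exampleKernel ξ * exp (α * conj ξ - ξ * conj α))]
  congr 1
  · simp
  · congr 1
    ext ξ
    rw [map_mul, ← Complex.exp_conj]
    congr 1
    · rw [exampleKernel, exampleKernel, conj_ofReal, norm_neg]
    · congr 1
      simp
      ring

theorem phaseSpaceFourier_exampleKernel_zero_re :
    (phaseSpaceFourier exampleKernel 0).re < 0 := by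
  -- At α = 0 the transform is the integral of the kernel divided by π², namely −1/(2π).
  have h : phaseSpaceFourier exampleKernel 0 = ((1 / Real.pi ^ 2 * -(Real.pi / 2) : ℝ) : ℂ) := by
    rw [← integral_exampleKernel_re, ofReal_mul, ← integral_complex_ofReal]
    simp_rw [ofReal_exampleKernel_re]
    simp [phaseSpaceFourier]
  rw [h, ofReal_re]
  have := Real.pi_pos
  rw [mul_neg, neg_lt_zero]
  positivity

end ExampleKernel

end PhaseSpace

theorem mainTheorem5 :
    (∀ Ω : ℂ → ℂ, Continuous Ω → Ω 0 = 1 →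
      (4 : ℝ) ∈ PhaseSpace.narcowichWignerSpectrum Ω →
      (0 : ℝ) ∉ PhaseSpace.narcowichWignerSpectrum Ω →
      (∃! E, PhaseSpace.IsFilteringMap Ω E) ∧
      ∀ E, PhaseSpace.IsFilteringMap Ω E →
        PhaseSpace.PreservesDensityOperators E ∧ ¬ PhaseSpace.IsCompletelyPositive E) ∧
    (Continuous PhaseSpace.exampleKernel ∧ PhaseSpace.exampleKernel 0 = 1 ∧
      (4 : ℝ) ∈ PhaseSpace.narcowichWignerSpectrum PhaseSpace.exampleKernel ∧
      (0 : ℝ) ∉ PhaseSpace.narcowichWignerSpectrum PhaseSpace.exampleKernel ∧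
      MeasureTheory.Integrable PhaseSpace.exampleKernel ∧
      (∀ α : ℂ, (PhaseSpace.phaseSpaceFourier PhaseSpace.exampleKernel α).im = 0) ∧
      ∃ α : ℂ, (PhaseSpace.phaseSpaceFourier PhaseSpace.exampleKernel α).re < 0) := by
  refine ⟨fun Ω hc h0 h4 hn => ⟨PhaseSpace.existsUnique_isFilteringMap hc h0 h4, fun E hE =>
    ⟨hE.preservesDensityOperators hc h0 h4,
      fun hcp => hn (hE.zero_mem_of_isCompletelyPositive hc h0 h4 hcp)⟩⟩,
    PhaseSpace.continuous_exampleKernel, PhaseSpace.exampleKernel_zero,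
    PhaseSpace.four_mem_narcowichWignerSpectrum_exampleKernel,
    PhaseSpace.zero_notMem_narcowichWignerSpectrum_exampleKernel,
    PhaseSpace.integrable_exampleKernel, PhaseSpace.phaseSpaceFourier_exampleKernel_im,
    0, PhaseSpace.phaseSpaceFourier_exampleKernel_zero_re⟩
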